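/- Let $K$ be a field, $\mathbb T^n$ the set of terms (monomials with coefficient $1$) in $x_1,\dots,x_n$, and $\mathbb T^n_{=i}$, $\mathbb T^n_{\le i}$ the sets of terms of degree $i$, resp. at most $i$. Linear spans are written $\langle\cdot\rangle_K$, ideals $\langle\cdot\rangle$. An *order ideal* is a finite set $\mathcal O\subseteq\mathbb T^n$ closed under factors; its border is $\partial\mathcal O=\{x_jt\mid j\in\{1,\dots,n\},\,t\in\mathcal O\}\setminus\mathcal O$, with $\partial\emptyset=\{1\}$. A finite set $\mathcal G$ is an *$\mathcal O$-border basis* of an ideal $I$ if $\mathcal G=\{g_b\mid b\in\partial\mathcal O\}$ with $g_b\in b+\langle\mathcal O\rangle_K$, $\langle\mathcal G\rangle=I$, and $K[x_1,\dots,x_n]=I\oplus\langle\mathcal O\rangle_K$. Let $I^{\le i}=\{p\in I\mid\deg p\le i\}$ (so $I^{\le-1}=0$). Let $\Lambda(I)$ be the set of order ideals $\mathcal O$ that support a border basis of $I$ and are degree-compatible, i.e. $|\mathcal O\cap\mathbb T^n_{=i}|=|\mathbb T^n_{=i}|-\dim I^{\le i}/I^{\le i-1}$ for all $i\ge0$.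 Fix a degree-compatible term ordering; $\mathrm{LT}$ and $\mathrm{LC}$ denote leading terms and leading coefficients, $\mathrm{LF}(p)$ is the homogeneous part of $p$ of degree $\deg p$. For a finite set $V$ of polynomials put $V^+=V\cup Vx_1\cup\dots\cup Vx_n$ and $V_i=\{v\in V\mid\deg v=i\}$. For $L=\mathbb T^n_{\le d}$ let $P(V,L)$ be the set of $z\in[0,1]^L$ with - $z_{m_1}\ge z_{m_2}$ for all $m_1,m_2\in L$ with $m_1\mid m_2$; - $\sum_{m\in\mathbb T^n_{=i}}z_m=|\mathbb T^n_{=i}|-\dim\langle\mathrm{LF}(V_i)\rangle_K$ for $0\le i\le d$; - $\sum_{m\in U}z_m\ge|U|-\operatorname{rk}\tilde U$ for $0\le i\le d$ and all $U\subseteq\mathbb T^n_{=i}$ with $|U|=\dim\langle\mathrm{LF}(V_i)\rangle_K$, where $\tilde U$ is the coefficient matrix of $\mathrm{LF}(V_i)$ restricted to the columns in $U$. For an integral point $z$ of $P(V,L)$ put $\mathcal O(z)=\{m\in L\mid z_m=1\}$. *Gaussian elimination.* $\mathrm{GaussEl}(V,G)$ starts with the list $V$ and treats the elements $f\in G$ one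 after the other in any order: as long as $f\ne0$ and some $v$ in the list satisfies $\mathrm{LT}(v)=\mathrm{LT}(f)$, it replaces $f$ by $f-\mathrm{LC}(f)v$, for the first such $v$; if the resulting $f$ is nonzero, it appends $f/\mathrm{LC}(f)$ to the list. It returns the set $W$ of appended elements. *Generalized border basis algorithm*, on input a finite set $F$: 1. Let $d:=\max_{f\in F}\deg f$ (with $d:=0$ if $F\subseteq\{0\}$). 2. ($L$-stable span, $L=\mathbb T^n_{\le d}$.) Let $V:=\mathrm{GaussEl}(\emptyset,F)$. Then repeat: let $W':=\mathrm{GaussEl}(V,V^+\setminus V)$ and $W:=\{w\in W'\mid\deg w\le d\}$; if $W\ne\emptyset$ put $V:=V\cup W$, otherwise stop repeating. 3. If $\mathbb T^n_{=d}\not\subseteq\mathrm{LT}(V)$, then increase $d$ by $1$ and go to step 2. 4. Choose an integral point $z$ of $P(V,L)$ and let $\mathcal O:=\mathcal O(z)$. 5. (Basis transformation.) Let $\ell=\max_{v\in V}\deg v$ (with $\ell:=0$ if $V=\emptyset$). Choose a linear order of the columns $\mathbb T^n_{\le\ell}$ in which every $t\in\mathcal O$ is to the right of every $m\notin\mathcal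 O$; the *head* of a polynomial is its left-most column with nonzero coefficient. Bring $V$ into reduced row echelon form $\mathcal G'$ by Gaussian elimination as above, with heads and their coefficients in place of $\mathrm{LT}$ and $\mathrm{LC}$, followed by back substitution: as long as the head of a row $h$ occurs in another row $g$, subtract the multiple of $h$ from $g$ that removes it. Return $\mathcal G:=\{g\in\mathcal G'\mid\text{the head of }g\text{ lies in }\partial\mathcal O\}$. **Proposition.** Let $F\subseteq K[x_1,\dots,x_n]$ be a finite set that generates a zero-dimensional ideal $I=\langle F\rangle$ (that is, $\dim_KK[x_1,\dots,x_n]/I<\infty$). Then, for any choices made in the course of the algorithm, the generalized border basis algorithm on input $F$ terminates, with an output. Whenever step 4 is reached, the order ideals that can be chosen there are exactly the elements of $\Lambda(I)$, and for the chosen $\mathcal O\in\Lambda(I)$ the algorithm returns the (unique) $\mathcal O$-border basis of $I$. In particular, for every $\mathcal O\in\Lambda(I)$ there is a run that computes the $\mathcal O$-border basis of $I$. -/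

import Mathlib

noncomputable section

namespace BorderBasis

open MvPolynomial

/-- Terms `x^m` in `n` indeterminates, represented by their exponent vectors `m`.
Divisibility `x^m ∣ x^m'` is `m ≤ m'`. -/
abbrev Mon (n : ℕ) : Type := Fin n →₀ ℕ

/-- The polynomial ring `K[x_1, …, x_n]`. -/
abbrev Poly (K : Type*) [Field K] (n : ℕ) : Type _ := MvPolynomial (Fin n) K

/-! ### Order ideals and border bases -/

/-- A finite set of terms that is closed under factors. -/
def IsOrderIdeal {n : ℕ} (O : Finset (Mon n)) : Prop :=
  ∀ t ∈ O, ∀ t' : Mon n, t' ≤ t → t' ∈ O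

open Classical in
/-- The border `∂O = {x_j t} \ O`, with the exception `∂∅ = {1}`. -/
def border {n : ℕ} (O : Finset (Mon n)) : Finset (Mon n) :=
  if O = ∅ then {0}
  else (Finset.univ.biUnion fun j : Fin n => O.image fun t => t + Finsupp.single j 1) \ O

open Classical in
/-- `G` is an `O`-border basis of the ideal `I`. The space `⟨O⟩` spanned by the terms in `O` is
`restrictSupport K O`. -/
structure IsBorderBasis {K : Type*} [Field K] {n : ℕ} (O : Finset (Mon n)) (I : Ideal (Poly K n))
    (G : Finset (Poly K n)) : Prop where
  orderIdeal : IsOrderIdeal O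
  form : ∃ α : Mon n → Mon n → K,
    G = (border O).image fun b => monomial b 1 - ∑ t ∈ O, monomial t (α b t)
  span_eq : Ideal.span (G : Set (Poly K n)) = I
  isCompl : IsCompl (I.restrictScalars K) (restrictSupport K (O : Set (Mon n)))

/-- `I^{≤ i}`, the elements of `I` of degree at most `i`. The index is an integer, so that
`I^{≤ -1} = 0`. -/
def degLE {K : Type*} [Field K] {n : ℕ} (I : Ideal (Poly K n)) (i : ℤ) : Submodule K (Poly K n) :=
  I.restrictScalars K ⊓ restrictSupport K {m : Mon n | (m.degree : ℤ) ≤ i}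

/-- `dim I^{≤ i} / I^{≤ i - 1}`. -/
def gradedDim {K : Type*} [Field K] {n : ℕ} (I : Ideal (Poly K n)) (i : ℕ) : ℕ :=
  Module.finrank K (↥(degLE I (i : ℤ)) ⧸ (degLE I ((i : ℤ) - 1)).submoduleOf (degLE I (i : ℤ)))

/-- `dim ⟨O^{=i}⟩ = dim ⟨T_{=i}⟩ - dim I^{≤ i} / I^{≤ i - 1}` for all `i` (as integers). -/
def IsDegreeCompatible {K : Type*} [Field K] {n : ℕ} (I : Ideal (Poly K n)) (O : Finset (Mon n)) :
    Prop :=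
  ∀ i : ℕ,
    (Module.finrank K (restrictSupport K {m : Mon n | m ∈ O ∧ m.degree = i}) : ℤ) =
      (Module.finrank K (restrictSupport K {m : Mon n | m.degree = i}) : ℤ) - (gradedDim I i : ℤ)

/-- `Λ(I)`: the degree-compatible order ideals that support a border basis of `I`. -/
def Lam {K : Type*} [Field K] {n : ℕ} (I : Ideal (Poly K n)) : Set (Finset (Mon n)) :=
  {O | IsOrderIdeal O ∧ IsDegreeCompatible I O ∧ ∃ G : Finset (Poly K n), IsBorderBasis O I G}

/-! ### The order ideal polytope `P(V, L)` -/

open Classical in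
/-- The universe `L = T_{≤ d}` of all terms of degree at most `d`. -/
def termsLE (n d : ℕ) : Finset (Mon n) :=
  (Finset.range (d + 1)).biUnion fun i => Finset.finsuppAntidiag Finset.univ i

theorem mem_termsLE {n d : ℕ} {m : Mon n} : m ∈ termsLE n d ↔ m.degree ≤ d := by
  simp only [termsLE, Finset.mem_biUnion, Finset.mem_range, Finset.mem_finsuppAntidiag,
    Finsupp.degree_eq_sum]
  constructor
  · rintro ⟨i, hi, h1, -⟩
    rw [h1]
    exact Nat.lt_succ_iff.mp hi
  · intro hm
    exact ⟨_, Nat.lt_succ_iff.mpr hm, rfl, Finset.subset_univ _⟩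

/-- The leading form: the part of maximal total degree. -/
def leadingForm {K : Type*} [Field K] {n : ℕ} (p : Poly K n) : Poly K n :=
  homogeneousComponent p.totalDegree p

/-- `V_i`, the elements of `V` of degree `i`. -/
def degPart {K : Type*} [Field K] {n : ℕ} (V : List (Poly K n)) (i : ℕ) : Set (Poly K n) :=
  {v | v ∈ V ∧ v.totalDegree = i}

/-- `dim ⟨LF(V_i)⟩`. -/
def lfDim {K : Type*} [Field K] {n : ℕ} (V : List (Poly K n)) (i : ℕ) : ℕ :=
  Module.finrank K (Submodule.span K (leadingForm '' degPart V i))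

/-- The coefficient matrix of `LF(V_i)`, restricted to the columns in `U`. -/
def lfMatrix {K : Type*} [Field K] {n d : ℕ} (V : List (Poly K n)) (i : ℕ)
    (U : Finset ↥(termsLE n d)) : Matrix ↥(degPart V i) ↥U K :=
  Matrix.of fun v u => coeff u.1.1 (leadingForm v.1)

open Classical in
/-- The order ideal polytope `P(V, L) ⊆ [0,1]^L` for `L = T_{≤ d}`. -/
def orderIdealPolytope {K : Type*} [Field K] {n : ℕ} (V : List (Poly K n)) (d : ℕ) :
    Set (↥(termsLE n d) → ℝ) :=
  {z | (∀ m₁ m₂ : ↥(termsLE n d), m₁.1 ≤ m₂.1 → z m₂ ≤ z m₁) ∧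
    (∀ i ≤ d, ∑ m ∈ Finset.univ.filter (fun m : ↥(termsLE n d) => m.1.degree = i), z m =
      (Module.finrank K (restrictSupport K {m : Mon n | m ∈ termsLE n d ∧ m.degree = i}) : ℝ) -
        (lfDim V i : ℝ)) ∧
    (∀ i ≤ d, ∀ U : Finset ↥(termsLE n d), (∀ m ∈ U, m.1.degree = i) → U.card = lfDim V i →
      (U.card : ℝ) - ((lfMatrix V i U).rank : ℝ) ≤ ∑ m ∈ U, z m) ∧
    ∀ m, z m ∈ Set.Icc (0 : ℝ) 1}

/-- `z` has integral coordinates. -/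
def IsIntegralPoint {n d : ℕ} (z : ↥(termsLE n d) → ℝ) : Prop :=
  ∀ m, ∃ k : ℤ, z m = (k : ℝ)

open Classical in
/-- `O(z) = {m ∈ L ∣ z_m = 1}`. -/
def orderIdealOf {n d : ℕ} (z : ↥(termsLE n d) → ℝ) : Finset (Mon n) :=
  (Finset.univ.filter fun m : ↥(termsLE n d) => z m = 1).image fun m => m.1

/-! ### The generalized border basis algorithm

The algorithm is given as a nondeterministic transition system. A term ordering `σ` is fixed for
the computation of the stable spans; every other choice (the next polynomial in an elimination, the
integral point of the polytope, the order of the columns, the order of the back substitutions) is a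
nondeterministic step. The subroutines are inlined: `Call` records the place from which Gaussian
elimination is called. -/

/-- A term ordering is degree-compatible if terms of smaller degree are smaller. -/
def IsDegreeOrder {n : ℕ} (σ : MonomialOrder (Fin n)) : Prop :=
  ∀ a b : Mon n, a.degree < b.degree → σ.toSyn a < σ.toSyn b

open Classical in
/-- `V⁺ = V ∪ V x_1 ∪ … ∪ V x_n`. -/
def neighborhood {K : Type*} [Field K] {n : ℕ} (V : Finset (Poly K n)) : Finset (Poly K n) :=
  V ∪ Finset.univ.biUnion fun j : Fin n => V.image fun v => v * X j

open Classical in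
/-- The head of a nonzero polynomial: its left-most column with nonzero coefficient, where `cols`
lists the columns from left to right. -/
def head {K : Type*} [Field K] {n : ℕ} (cols : List (Mon n)) (p : Poly K n) : Mon n :=
  (cols.find? fun m => decide (coeff m p ≠ 0)).getD 0

/-- `cols` lists all terms of degree at most `ℓ` once each, those in `O` to the right of those not
in `O`. -/
def IsColumnOrder {n : ℕ} (ℓ : ℕ) (O : Finset (Mon n)) (cols : List (Mon n)) : Prop :=
  cols.Nodup ∧ (∀ m, m ∈ cols ↔ m.degree ≤ ℓ) ∧ cols.Pairwise fun a b => a ∈ O → b ∈ O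

/-- The maximal degree of the elements of a finite set of polynomials. -/
def maxDegree {K : Type*} [Field K] {n : ℕ} (V : Finset (Poly K n)) : ℕ :=
  V.sup totalDegree

/-- The three places at which Gaussian elimination is called. -/
inductive Call (n : ℕ) : Type
  /-- first step of the stable span computation for `L = T_{≤ d}` -/
  | spanInit (d : ℕ)
  /-- extension step of the stable span computation for `L = T_{≤ d}` -/
  | spanExtend (d : ℕ)
  /-- basis transformation to the order ideal `O` with the columns ordered as in `cols` -/
  | basisTrans (O : Finset (Mon n)) (cols : List (Mon n))

/-- The leading term used by the elimination: the one for `σ` in the stable span computation, the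
head in the basis transformation. -/
def Call.lead {K : Type*} [Field K] {n : ℕ} (σ : MonomialOrder (Fin n)) :
    Call n → Poly K n → Mon n
  | .spanInit _ => fun p => σ.degree p
  | .spanExtend _ => fun p => σ.degree p
  | .basisTrans _ cols => fun p => head cols p

/-- The configurations of the algorithm. -/
inductive State (K : Type*) [Field K] (n : ℕ) : Type _
  /-- about to compute the `T_{≤ d}`-stable span of the input -/
  | span (d : ℕ)
  /-- Gaussian elimination called with initial set `V`; `W` has been found, `H` is left to do -/
  | gauss (c : Call n) (V W : List (Poly K n)) (H : Finset (Poly K n))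
  /-- Gaussian elimination, reducing `f`, which is next compared with entry `i` of `V ++ W` -/
  | reduce (c : Call n) (V W : List (Poly K n)) (H : Finset (Poly K n)) (f : Poly K n) (i : ℕ)
  /-- Gaussian elimination called with initial set `V` has returned `W` -/
  | returned (c : Call n) (V W : List (Poly K n))
  /-- about to extend `V` in the `T_{≤ d}`-stable span computation -/
  | extend (d : ℕ) (V : List (Poly K n))
  /-- the `T_{≤ d}`-stable span computation has returned `V` -/
  | test (d : ℕ) (V : List (Poly K n))
  /-- about to choose an order ideal -/
  | choose (d : ℕ) (V : List (Poly K n))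
  /-- about to transform `V` for the chosen order ideal `O` -/
  | transform (V : List (Poly K n)) (O : Finset (Mon n))
  /-- back substitution, which completes the reduced row echelon form of the rows `G` -/
  | backSubst (O : Finset (Mon n)) (cols : List (Mon n)) (G : List (Poly K n))
  /-- the algorithm has stopped with chosen order ideal `O` and output `G` -/
  | done (O : Finset (Mon n)) (G : Finset (Poly K n))

open Classical in
/-- One step of the generalized border basis algorithm on input `F`. -/
inductive Step {K : Type*} [Field K] {n : ℕ} (σ : MonomialOrder (Fin n)) (F : Finset (Poly K n)) :
    State K n → State K n → Prop
  -- Gaussian elimination: choose some `f ∈ H` and remove it from `H`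
  | pick (c : Call n) (V W : List (Poly K n)) (H : Finset (Poly K n)) (f : Poly K n) (hf : f ∈ H) :
      Step σ F (.gauss c V W H) (.reduce c V W (H.erase f) f 0)
  -- the leading terms of `f` and of entry `i` agree: subtract and start again
  | cancel (c : Call n) (V W : List (Poly K n)) (H : Finset (Poly K n)) (f : Poly K n) (i : ℕ)
      (v : Poly K n) (hf : f ≠ 0) (hv : (V ++ W)[i]? = some v) (hl : c.lead σ f = c.lead σ v) :
      Step σ F (.reduce c V W H f i) (.reduce c V W H (f - C (coeff (c.lead σ f) f) * v) 0)
  -- they differ: go to the next entry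
  | next (c : Call n) (V W : List (Poly K n)) (H : Finset (Poly K n)) (f : Poly K n) (i : ℕ)
      (v : Poly K n) (hf : f ≠ 0) (hv : (V ++ W)[i]? = some v) (hl : c.lead σ f ≠ c.lead σ v) :
      Step σ F (.reduce c V W H f i) (.reduce c V W H f (i + 1))
  -- `f` has been reduced to zero
  | drop (c : Call n) (V W : List (Poly K n)) (H : Finset (Poly K n)) (i : ℕ) :
      Step σ F (.reduce c V W H 0 i) (.gauss c V W H)
  -- `f` is nonzero and no entry is left: normalize and append
  | append (c : Call n) (V W : List (Poly K n)) (H : Finset (Poly K n)) (f : Poly K n) (i : ℕ)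
      (hf : f ≠ 0) (hi : (V ++ W).length ≤ i) :
      Step σ F (.reduce c V W H f i)
        (.gauss c V (W ++ [C (coeff (c.lead σ f) f)⁻¹ * f]) H)
  -- `H` is empty: return `W`
  | ret (c : Call n) (V W : List (Poly K n)) :
      Step σ F (.gauss c V W ∅) (.returned c V W)
  -- Stable span computation: eliminate in `F`, starting with the empty set
  | spanStart (d : ℕ) : Step σ F (.span d) (.gauss (.spanInit d) [] [] F)
  | spanInitRet (d : ℕ) (V W : List (Poly K n)) :
      Step σ F (.returned (.spanInit d) V W) (.extend d W)
  -- eliminate in `V⁺ \ V`, starting with `V`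
  | spanExtend (d : ℕ) (V : List (Poly K n)) :
      Step σ F (.extend d V)
        (.gauss (.spanExtend d) V [] (neighborhood V.toFinset \ V.toFinset))
  -- keep the new elements of degree at most `d`; repeat if there are any, otherwise return `V`
  | spanMore (d : ℕ) (V W' W : List (Poly K n))
      (hW : W = W'.filter fun w => decide (w.totalDegree ≤ d)) (hne : W ≠ []) :
      Step σ F (.returned (.spanExtend d) V W') (.extend d (V ++ W))
  | spanStop (d : ℕ) (V W' : List (Poly K n))
      (hW : (W'.filter fun w => decide (w.totalDegree ≤ d)) = []) :
      Step σ F (.returned (.spanExtend d) V W') (.test d V)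
  -- Main loop: increase the degree unless every term of degree `d` is a leading term
  | increase (d : ℕ) (V : List (Poly K n))
      (h : ¬ ∀ t : Mon n, t.degree = d → ∃ v ∈ V, σ.degree v = t) :
      Step σ F (.test d V) (.span (d + 1))
  | pass (d : ℕ) (V : List (Poly K n))
      (h : ∀ t : Mon n, t.degree = d → ∃ v ∈ V, σ.degree v = t) :
      Step σ F (.test d V) (.choose d V)
  -- choose an integral point of the order ideal polytope
  | choosePoint (d : ℕ) (V : List (Poly K n)) (z : ↥(termsLE n d) → ℝ)
      (hz : z ∈ orderIdealPolytope V d) (hint : IsIntegralPoint z) :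
      Step σ F (.choose d V) (.transform V (orderIdealOf z))
  -- Basis transformation: permute the columns and eliminate with heads as leading terms
  | permute (V : List (Poly K n)) (O : Finset (Mon n)) (cols : List (Mon n))
      (hcols : IsColumnOrder (maxDegree V.toFinset) O cols) :
      Step σ F (.transform V O) (.gauss (.basisTrans O cols) [] [] V.toFinset)
  | transRet (O : Finset (Mon n)) (cols : List (Mon n)) (V W : List (Poly K n)) :
      Step σ F (.returned (.basisTrans O cols) V W) (.backSubst O cols W)
  -- the head of a row `h` occurs in another row `g`: remove it from `g`
  | subst (O : Finset (Mon n)) (cols : List (Mon n)) (A B : List (Poly K n)) (g h : Poly K n)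
      (hh : h ∈ A ++ B) (hc : coeff (head cols h) g ≠ 0) :
      Step σ F (.backSubst O cols (A ++ g :: B))
        (.backSubst O cols (A ++ (g - C (coeff (head cols h) g) * h) :: B))
  -- the rows are in reduced row echelon form: return those whose head is in the border of `O`
  | finish (O : Finset (Mon n)) (cols : List (Mon n)) (G : List (Poly K n))
      (hred : ∀ (A B : List (Poly K n)) (g : Poly K n), G = A ++ g :: B →
        ∀ h ∈ A ++ B, coeff (head cols h) g = 0) :
      Step σ F (.backSubst O cols G)
        (.done O (G.toFinset.filter fun g => head cols g ∈ border O))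

/-- The algorithm starts with `d = max {deg f ∣ f ∈ F}`. -/
def start {K : Type*} [Field K] {n : ℕ} (F : Finset (Poly K n)) : State K n :=
  .span (maxDegree F)

/-- `s` occurs in some run of the algorithm on input `F`. -/
def Reachable {K : Type*} [Field K] {n : ℕ} (σ : MonomialOrder (Fin n)) (F : Finset (Poly K n))
    (s : State K n) : Prop :=
  Relation.ReflTransGen (Step σ F) (start F) s

/-- Every run of the algorithm on input `F` is finite. -/
def Terminates {K : Type*} [Field K] {n : ℕ} (σ : MonomialOrder (Fin n)) (F : Finset (Poly K n)) :
    Prop :=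
  Acc (fun t s => Step σ F s t) (start F)

end BorderBasis

end

noncomputable section

namespace BorderBasis

open MvPolynomial

variable {K : Type*} [Field K] {n : ℕ}

/-! Let `V` pass the test in step 3 and let `U` be its span. Then `U` is stable in degree `d`,
contains `F`, lies in `I`, and modulo `U` every polynomial of degree at most `d` has a
representative of degree less than `d`. Multiplication by `x_j` followed by a linear choice of
representatives gives commuting operators, since the differences to be compared lie in `U + U x_1 +
… + U x_n` and have degree at most `d`. Evaluating polynomials at these operators kills all of `I`
and computes representatives in degree at most `d`, so `U = I^{≤ d}` (`IsStable.mem_of_mem_span`).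

Membership in `Λ(I)` depends only on leading forms: in every degree `i` the terms of `O` must span a
complement of the space of leading forms of `I` (`mem_Lam_iff`). For `i ≤ d` this space is spanned
by the leading forms of `V_i`; for `i ≥ d` it is everything. For an integral point, the rank
inequality for the terms of degree `i` outside `O` has left side `0`, so the matrix has full rank:
no nonzero leading form is supported in `O`. The cardinality condition then gives the complement
(`IsDegreeBasis.mem_Lam_iff_exists`).

For every term `b ∉ O` of degree at most `d`, the difference of `b` and its normal form in `⟨O⟩`
lies in the row space and has head `b`. Hence all these terms are heads, and a row of the reduced
echelon form has, besides its head, only terms of `O` (`IsTransInput.isBorderBasis`).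

All this is carried along runs by the invariant `Inv`. Runs do not get stuck, because the terms that
are not leading terms of `I` form an element of `Λ(I)`. They are finite by nested well-founded
measures; the main loop ends because finitely many membership certificates fit into every stable
span of large degree (`exists_forall_isStable_degree`). -/

theorem mem_restrictSupport {s : Set (Mon n)} {p : Poly K n} :
    p ∈ restrictSupport K s ↔ ∀ m, coeff m p ≠ 0 → m ∈ s := by
  rw [mem_restrictSupport_iff]
  exact ⟨fun h m hm => h (mem_support_iff.2 hm), fun h m hm => h m (mem_support_iff.1 hm)⟩

/-! ### Leading terms with respect to a well-founded relation -/

/-- `lead` picks from every nonzero polynomial in `D` the term of its support above all others with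
respect to the well-founded transitive relation `R`. -/
structure IsLeadFun (R : Mon n → Mon n → Prop) (D : Submodule K (Poly K n))
    (lead : Poly K n → Mon n) : Prop where
  trans : ∀ a b c, R a b → R b c → R a c
  wf : WellFounded R
  coeff_ne : ∀ p ∈ D, p ≠ 0 → coeff (lead p) p ≠ 0
  rel : ∀ p ∈ D, ∀ m, coeff m p ≠ 0 → m ≠ lead p → R m (lead p)

/-- The polynomials in `V` lie in `D`, have leading coefficient one, and have distinct leading
terms. -/
structure IsEchelon (D : Submodule K (Poly K n)) (lead : Poly K n → Mon n)
    (V : List (Poly K n)) : Prop where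
  mem : ∀ v ∈ V, v ∈ D
  monic : ∀ v ∈ V, coeff (lead v) v = 1
  nodup : (V.map lead).Nodup

/-- The linear span of the members of a list. -/
abbrev listSpan (V : List (Poly K n)) : Submodule K (Poly K n) := Submodule.span K {v | v ∈ V}

theorem mem_listSpan {V : List (Poly K n)} {v : Poly K n} (hv : v ∈ V) : v ∈ listSpan V :=
  Submodule.subset_span hv

theorem listSpan_append (V W : List (Poly K n)) :
    listSpan (V ++ W) = listSpan V ⊔ listSpan W := by
  rw [listSpan, listSpan, listSpan, ← Submodule.span_union]
  congr 1
  ext v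
  simp

namespace IsEchelon

variable {D : Submodule K (Poly K n)} {lead : Poly K n → Mon n} {V W : List (Poly K n)}

theorem ne_zero (hV : IsEchelon D lead V) {v : Poly K n} (hv : v ∈ V) : v ≠ 0 := by
  rintro rfl
  simpa using hV.monic 0 hv

theorem injOn (hV : IsEchelon D lead V) {v w : Poly K n} (hv : v ∈ V) (hw : w ∈ V)
    (h : lead v = lead w) : v = w :=
  List.inj_on_of_nodup_map hV.nodup hv hw h

theorem sublist (hV : IsEchelon D lead V) (h : W.Sublist V) : IsEchelon D lead W where
  mem v hv := hV.mem v (h.subset hv)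
  monic v hv := hV.monic v (h.subset hv)
  nodup := hV.nodup.sublist (h.map lead)

theorem nil : IsEchelon D lead [] where
  mem := by simp
  monic := by simp
  nodup := by simp

theorem listSpan_le (hV : IsEchelon D lead V) : listSpan V ≤ D :=
  Submodule.span_le.2 hV.mem

end IsEchelon

namespace IsLeadFun

variable {R : Mon n → Mon n → Prop} {D : Submodule K (Poly K n)} {lead : Poly K n → Mon n}

theorem irrefl (h : IsLeadFun R D lead) (a : Mon n) : ¬ R a a :=
  fun ha => h.wf.asymmetric _ _ ha ha

theorem lead_eq (h : IsLeadFun R D lead) {p : Poly K n} (hp : p ∈ D) {m : Mon n}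
    (hm : coeff m p ≠ 0) (hmax : ∀ m', coeff m' p ≠ 0 → m' ≠ m → R m' m) : lead p = m := by
  by_contra hne
  have h1 := h.rel p hp m hm (Ne.symm hne)
  have h2 := hmax (lead p) (h.coeff_ne p hp (by rintro rfl; simp at hm)) hne
  exact h.wf.asymmetric _ _ h1 h2

/-- A maximal leading term among the members that occur in `p` cannot cancel, since leading terms
are distinct. The last part bounds which members are needed; with a degree-compatible ordering it
becomes a bound on their degrees. -/
theorem exists_lead_eq (h : IsLeadFun R D lead) {V : List (Poly K n)} (hV : IsEchelon D lead V)
    {p : Poly K n} (hp : p ∈ listSpan V) (hp0 : p ≠ 0) :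
    ∃ v ∈ V, lead v = lead p ∧
      p ∈ Submodule.span K {w | w ∈ V ∧ ¬ R (lead p) (lead w)} := by
  obtain ⟨c, hc, hsum⟩ := Submodule.mem_span_set.1 hp
  have hne : c.support.Nonempty := by
    rw [Finset.nonempty_iff_ne_empty]
    rintro h0
    rw [Finsupp.support_eq_empty] at h0
    subst h0
    exact hp0 (by simpa using hsum.symm)
  obtain ⟨v, hv, hmax⟩ : ∃ v ∈ c.support, ∀ w ∈ c.support, ¬ R (lead v) (lead w) := by
    -- `R` need not be total, so a maximal leading term is taken as a minimal element of the
    -- reversed relation on the finite support.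
    let S : c.support → c.support → Prop := fun a b => R (lead b.1) (lead a.1)
    have : IsTrans c.support S := ⟨fun a b d h1 h2 => h.trans _ _ _ h2 h1⟩
    have : Std.Irrefl S := ⟨fun a => h.irrefl _⟩
    have hwf : WellFounded S := Finite.wellFounded_of_trans_of_irrefl S
    obtain ⟨v, hv⟩ := hne
    obtain ⟨m, -, hm⟩ := hwf.has_min Set.univ ⟨⟨v, hv⟩, trivial⟩
    exact ⟨m.1, m.2, fun w hw => hm ⟨w, hw⟩ trivial⟩
  have hcoeff : ∀ m, coeff m p = ∑ w ∈ c.support, c w * coeff m w := by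
    intro m
    rw [← hsum, Finsupp.sum, coeff_sum]
    simp
  have hother : ∀ w ∈ c.support, w ≠ v → coeff (lead v) w = 0 := by
    intro w hw hwv
    by_contra h0
    refine hmax w hw (h.rel w (hV.mem w (hc hw)) _ h0 fun he => hwv ?_)
    exact (hV.injOn (hc hv) (hc hw) he).symm
  have hv1 : coeff (lead v) p ≠ 0 := by
    rw [hcoeff, Finset.sum_eq_single v (fun w hw hwv => by rw [hother w hw hwv, mul_zero])
      (fun h' => absurd hv h'), hV.monic v (hc hv), mul_one]
    exact Finsupp.mem_support_iff.1 hv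
  have hpD : p ∈ D := hV.listSpan_le hp
  have hlead : lead v = lead p := by
    by_contra hne'
    have h1 := h.rel p hpD _ hv1 hne'
    have h2 := h.coeff_ne p hpD hp0
    rw [hcoeff] at h2
    obtain ⟨w, hw, hw0⟩ := Finset.exists_ne_zero_of_sum_ne_zero h2
    have hw0' : coeff (lead p) w ≠ 0 := right_ne_zero_of_mul hw0
    by_cases he : lead p = lead w
    · exact hmax w hw (he ▸ h1)
    · exact hmax w hw (h.trans _ _ _ h1 (h.rel w (hV.mem w (hc hw)) _ hw0' he))
  refine ⟨v, hc hv, hlead, ?_⟩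
  have hmem : c.sum (fun mi r => r • mi) ∈ Submodule.span K {w | w ∈ V ∧ ¬ R (lead p) (lead w)} := by
    refine Submodule.sum_mem _ fun w hw => Submodule.smul_mem _ _ (Submodule.subset_span ?_)
    exact ⟨hc hw, by rw [← hlead]; exact hmax w hw⟩
  rwa [hsum] at hmem

/-- Cancelling the leading term lowers it. -/
theorem rel_sub_mul (h : IsLeadFun R D lead) {f v : Poly K n} (hf : f ∈ D) (hv : v ∈ D)
    (hl : lead f = lead v) (hv1 : coeff (lead v) v = 1)
    (h0 : f - C (coeff (lead f) f) * v ≠ 0) :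
    R (lead (f - C (coeff (lead f) f) * v)) (lead f) := by
  have hmem : f - C (coeff (lead f) f) * v ∈ D := by
    rw [C_mul']
    exact D.sub_mem hf (D.smul_mem _ hv)
  have hc := h.coeff_ne _ hmem h0
  set m := lead (f - C (coeff (lead f) f) * v) with hm
  rw [coeff_sub, coeff_C_mul] at hc
  have hml : m ≠ lead f := by
    intro he
    rw [he] at hc
    rw [hl, hv1] at hc
    simp at hc
  by_cases hfm : coeff m f = 0
  · rw [hl]
    refine h.rel v hv m (fun hvm => hc (by rw [hfm, hvm]; simp)) (hl ▸ hml)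
  · exact h.rel f hf m hfm hml

end IsLeadFun

/-! ### The two leading term functions of the algorithm -/

theorem isLeadFun_degree (σ : MonomialOrder (Fin n)) :
    IsLeadFun (fun a b => σ.toSyn a < σ.toSyn b) (⊤ : Submodule K (Poly K n)) σ.degree where
  trans _ _ _ := lt_trans
  wf := InvImage.wf σ.toSyn wellFounded_lt
  coeff_ne _ _ hp := σ.coeff_degree_ne_zero_iff.2 hp
  rel _ _ _ hm hne := lt_of_le_of_ne (σ.le_degree (mem_support_iff.2 hm))
    fun h => hne (σ.toSyn.injective h)

/-- The term `m` guarantees that the search succeeds, so the default value `0` of `head` is never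
taken. -/
theorem head_spec {cols : List (Mon n)} {p : Poly K n} {m : Mon n} (hm : m ∈ cols)
    (hc : coeff m p ≠ 0) :
    coeff (head cols p) p ≠ 0 ∧ cols.idxOf (head cols p) ≤ cols.idxOf m ∧ head cols p ∈ cols := by
  classical
  induction cols with
  | nil => simp at hm
  | cons a l ih =>
    by_cases ha : coeff a p = 0
    · have hhead : head (a :: l) p = head l p := by
        simp [head, ha]
      have hma : m ≠ a := by rintro rfl; exact hc ha
      obtain ⟨h1, h2, h3⟩ := ih ((List.mem_cons.1 hm).resolve_left hma)
      have hha : head l p ≠ a := fun h => h1 (h ▸ ha)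
      rw [hhead]
      refine ⟨h1, ?_, List.mem_cons_of_mem _ h3⟩
      rw [List.idxOf_cons_ne _ hha.symm, List.idxOf_cons_ne _ hma.symm]
      omega
    · have hhead : head (a :: l) p = a := by
        simp [head, ha]
      rw [hhead]
      exact ⟨ha, by simp, by simp⟩

/-- Terms are compared by their distance from the right end of the list. Terms that are no columns
all get the value `0`, hence the restriction to polynomials supported in the columns. -/
theorem isLeadFun_head (cols : List (Mon n)) :
    IsLeadFun (fun a b => cols.length - cols.idxOf a < cols.length - cols.idxOf b)
      (restrictSupport K {m | m ∈ cols}) (head cols) where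
  trans _ _ _ := lt_trans
  wf := InvImage.wf (fun a => cols.length - cols.idxOf a) wellFounded_lt
  coeff_ne p hp h0 := by
    obtain ⟨m, hm⟩ := MvPolynomial.ne_zero_iff.1 h0
    exact (head_spec (mem_restrictSupport.1 hp m hm) hm).1
  rel p hp m hm hne := by
    have hmc : m ∈ cols := mem_restrictSupport.1 hp m hm
    obtain ⟨h1, h2, h3⟩ := head_spec hmc hm
    have h4 : cols.idxOf (head cols p) ≠ cols.idxOf m := fun h =>
      hne ((List.idxOf_inj h3).1 h).symm
    have h5 := List.idxOf_lt_length_iff.2 h3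
    have h6 := List.idxOf_lt_length_iff.2 hmc
    omega

/-! ### Leading forms of an ideal -/

theorem finite_restrictSupport {s : Set (Mon n)} (hs : s.Finite) :
    Module.Finite K (restrictSupport K s) := by
  have := hs.to_subtype
  exact Module.Finite.of_basis (basisRestrictSupport K s)

theorem finrank_restrictSupport (s : Set (Mon n)) :
    Module.finrank K (restrictSupport K s) = s.ncard :=
  Module.finrank_eq_nat_card_basis (basisRestrictSupport K s)

theorem finite_restrictSupport_degree (i : ℕ) :
    Module.Finite K (restrictSupport K {m : Mon n | m.degree = i}) :=
  finite_restrictSupport (Finsupp.finite_of_degree_eq i)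

theorem mem_degLE {I : Ideal (Poly K n)} {i : ℤ} {p : Poly K n} :
    p ∈ degLE I i ↔ p ∈ I ∧ ∀ m, coeff m p ≠ 0 → (m.degree : ℤ) ≤ i := by
  rw [degLE, Submodule.mem_inf, mem_restrictSupport]
  rfl

/-- The space of the homogeneous components of degree `i` of the elements of `I` of degree at most
`i`. -/
def lfSpace (I : Ideal (Poly K n)) (i : ℕ) : Submodule K (Poly K n) :=
  (degLE I (i : ℤ)).map (homogeneousComponent i)

theorem mem_lfSpace {I : Ideal (Poly K n)} {i : ℕ} {w : Poly K n} :
    w ∈ lfSpace I i ↔ ∃ q ∈ I, (∀ m, coeff m q ≠ 0 → m.degree ≤ i) ∧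
      homogeneousComponent i q = w := by
  simp [lfSpace, mem_degLE, and_assoc]

theorem homogeneousComponent_mem_restrictSupport (i : ℕ) (p : Poly K n) :
    homogeneousComponent i p ∈ restrictSupport K {m : Mon n | m.degree = i} := by
  rw [mem_restrictSupport]
  intro m hm
  rw [coeff_homogeneousComponent] at hm
  by_contra h
  exact hm (if_neg h)

theorem lfSpace_le (I : Ideal (Poly K n)) (i : ℕ) :
    lfSpace I i ≤ restrictSupport K {m : Mon n | m.degree = i} := by
  rintro _ ⟨p, -, rfl⟩
  exact homogeneousComponent_mem_restrictSupport i p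

theorem finite_lfSpace (I : Ideal (Poly K n)) (i : ℕ) : Module.Finite K (lfSpace I i) :=
  have := finite_restrictSupport_degree (K := K) (n := n) i
  Submodule.finiteDimensional_of_le (lfSpace_le I i)

/-- The homogeneous component of degree `i`, as a map on `I^{≤ i}`, has kernel `I^{≤ i - 1}`. -/
theorem finrank_lfSpace (I : Ideal (Poly K n)) (i : ℕ) :
    Module.finrank K (lfSpace I i) = gradedDim I i := by
  let f : degLE I (i : ℤ) →ₗ[K] Poly K n := (homogeneousComponent i).domRestrict (degLE I (i : ℤ))
  have hker : LinearMap.ker f = (degLE I ((i : ℤ) - 1)).submoduleOf (degLE I (i : ℤ)) := by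
    ext ⟨p, hp⟩
    rw [mem_degLE] at hp
    simp only [f, LinearMap.mem_ker, LinearMap.domRestrict_apply, Submodule.submoduleOf,
      Submodule.mem_comap, Submodule.subtype_apply, mem_degLE]
    constructor
    · refine fun h => ⟨hp.1, fun m hm => ?_⟩
      have h1 := hp.2 m hm
      have h2 : m.degree ≠ i := by
        rintro rfl
        have := congrArg (coeff m) h
        rw [coeff_homogeneousComponent, if_pos rfl, coeff_zero] at this
        exact hm this
      omega
    · rintro ⟨-, h⟩
      ext m
      rw [coeff_homogeneousComponent, coeff_zero]
      split_ifs with hm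
      · by_contra h0
        have := h m h0
        omega
      · rfl
  have hrange : LinearMap.range f = lfSpace I i := by
    rw [lfSpace, LinearMap.range_domRestrict]
  rw [gradedDim, ← hker, ← hrange]
  exact (LinearEquiv.finrank_eq f.quotKerEquivRange).symm

/-- In every degree the terms of `O` span a complement of the leading forms of `I`. -/
def IsGradedCompl (I : Ideal (Poly K n)) (O : Finset (Mon n)) : Prop :=
  ∀ i : ℕ, Disjoint (lfSpace I i) (restrictSupport K {m : Mon n | m ∈ O ∧ m.degree = i}) ∧
    restrictSupport K {m : Mon n | m.degree = i} ≤
      lfSpace I i ⊔ restrictSupport K {m : Mon n | m ∈ O ∧ m.degree = i}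

/-- Division from the top degree downwards: the highest component is split into a leading form of
`I` and a part in `⟨O⟩`, and both are subtracted. The spanning hypothesis is needed only below `i`,
so the lemma is available in an induction over the degree. -/
theorem exists_sub_mem_of_graded {I : Ideal (Poly K n)} {O : Finset (Mon n)} {i : ℕ}
    (h : ∀ j < i, restrictSupport K {m : Mon n | m.degree = j} ≤
      lfSpace I j ⊔ restrictSupport K {m : Mon n | m ∈ O ∧ m.degree = j})
    {p : Poly K n} (hp : ∀ m, coeff m p ≠ 0 → m.degree < i) :
    ∃ q ∈ I, p - q ∈ restrictSupport K {m : Mon n | m ∈ O ∧ m.degree < i} := by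
  induction i generalizing p with
  | zero =>
    have : p = 0 := by
      by_contra h0
      obtain ⟨m, hm⟩ := MvPolynomial.ne_zero_iff.1 h0
      exact absurd (hp m hm) (by omega)
    exact ⟨0, I.zero_mem, by simp [this]⟩
  | succ i ih =>
    obtain ⟨w, hw, e, he, hwe⟩ := Submodule.mem_sup.1
      (h i (by omega) (homogeneousComponent_mem_restrictSupport i p))
    obtain ⟨q, hqI, hq, rfl⟩ := mem_lfSpace.1 hw
    rw [mem_restrictSupport] at he
    obtain ⟨q', hq'I, hq'⟩ := ih (fun j hj => h j (by omega)) (p := p - q - e) (by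
      intro m hm
      have h1 : m.degree ≤ i := by
        by_contra hlt
        apply hm
        have h1 : coeff m p = 0 := by
          by_contra h0
          have := hp m h0
          omega
        have h2 : coeff m q = 0 := by
          by_contra h0
          exact hlt (hq m h0)
        have h3 : coeff m e = 0 := by
          by_contra h0
          have := (he m h0).2
          omega
        simp [h1, h2, h3]
      refine lt_of_le_of_ne h1 fun hmi => hm ?_
      have := congrArg (coeff m) hwe
      rw [coeff_add, coeff_homogeneousComponent, coeff_homogeneousComponent, if_pos hmi,
        if_pos hmi] at this
      simp [← this])
    refine ⟨q + q', I.add_mem hqI hq'I, ?_⟩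
    have h4 : p - (q + q') = (p - q - e - q') + e := by ring
    rw [h4]
    refine Submodule.add_mem _ (restrictSupport_mono K (fun m hm => ?_) hq')
      (mem_restrictSupport.2 fun m hm => ⟨(he m hm).1, ?_⟩)
    · exact ⟨hm.1, Nat.lt_succ_of_lt hm.2⟩
    · exact (he m hm).2 ▸ Nat.lt_succ_self _

theorem restrictSupport_le_mono {O : Finset (Mon n)} {P : Mon n → Prop} :
    restrictSupport K {m : Mon n | m ∈ O ∧ P m} ≤ restrictSupport K (O : Set (Mon n)) :=
  restrictSupport_mono K fun _ hm => hm.1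

/-- The top component of an element of `I ∩ ⟨O⟩` is both a leading form and in `⟨O⟩`, hence zero;
spanning is the division above. -/
theorem IsGradedCompl.isCompl {I : Ideal (Poly K n)} {O : Finset (Mon n)}
    (h : IsGradedCompl I O) :
    IsCompl (I.restrictScalars K) (restrictSupport K (O : Set (Mon n))) := by
  constructor
  · rw [Submodule.disjoint_def]
    intro p hpI hpO
    by_contra h0
    rw [mem_restrictSupport] at hpO
    have hdeg : ∀ m, coeff m p ≠ 0 → m.degree ≤ p.totalDegree := fun m hm =>
      le_totalDegree (mem_support_iff.2 hm)
    have hmem : homogeneousComponent p.totalDegree p ∈ lfSpace I p.totalDegree :=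
      mem_lfSpace.2 ⟨p, hpI, hdeg, rfl⟩
    have hzero := Submodule.disjoint_def.1 (h p.totalDegree).1 _ hmem (by
      rw [mem_restrictSupport]
      intro m hm
      rw [coeff_homogeneousComponent] at hm
      split_ifs at hm with hd
      · exact ⟨hpO m hm, hd⟩
      · exact absurd rfl hm)
    obtain ⟨m, hm, hmd⟩ := Finset.exists_mem_eq_sup p.support
      (Finset.nonempty_iff_ne_empty.2 (by simpa using h0)) Finsupp.degree
    have hmd' : m.degree = p.totalDegree := hmd.symm
    have := congrArg (coeff m) hzero
    rw [coeff_homogeneousComponent, if_pos hmd', coeff_zero] at this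
    exact mem_support_iff.1 hm this
  · rw [codisjoint_iff, eq_top_iff]
    rintro p -
    obtain ⟨q, hqI, hq⟩ := exists_sub_mem_of_graded (I := I) (O := O) (i := p.totalDegree + 1)
      (fun j _ => (h j).2) (p := p)
      (fun m hm => Nat.lt_succ_of_le (le_totalDegree (mem_support_iff.2 hm)))
    exact Submodule.mem_sup.2 ⟨q, hqI, p - q, restrictSupport_le_mono hq, by ring⟩

theorem IsGradedCompl.isDegreeCompatible {I : Ideal (Poly K n)} {O : Finset (Mon n)}
    (h : IsGradedCompl I O) : IsDegreeCompatible I O := by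
  intro i
  have h1 := finite_lfSpace I i
  have h2 := finite_restrictSupport_degree (K := K) (n := n) i
  have hle : restrictSupport K {m : Mon n | m ∈ O ∧ m.degree = i} ≤
      restrictSupport K {m : Mon n | m.degree = i} := restrictSupport_mono K fun _ hm => hm.2
  have h3 := Submodule.finiteDimensional_of_le hle
  have h5 := Submodule.finrank_sup_add_finrank_inf_eq (lfSpace I i)
    (restrictSupport K {m : Mon n | m ∈ O ∧ m.degree = i})
  rw [(h i).1.eq_bot, finrank_bot, le_antisymm (sup_le (lfSpace_le I i) hle) (h i).2,
    finrank_lfSpace] at h5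
  show (Module.finrank K (restrictSupport K {m : Mon n | m ∈ O ∧ m.degree = i}) : ℤ) =
    (Module.finrank K (restrictSupport K {m : Mon n | m.degree = i}) : ℤ) - (gradedDim I i : ℤ)
  have h6 : Module.finrank K (restrictSupport K {m : Mon n | m.degree = i}) + 0 = gradedDim I i +
      Module.finrank K (restrictSupport K {m : Mon n | m ∈ O ∧ m.degree = i}) := h5
  omega

/-- If the leading form of `q ∈ I` lies in `⟨O⟩`, the lower part of `q` can be reduced modulo some
`r ∈ I` into `⟨O⟩` in lower degrees. Then `q - r` lies in `I ∩ ⟨O⟩`, so `q = r`, and the leading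
form is minus a polynomial of lower degree, hence zero. Spanning then follows by counting
dimensions. -/
theorem isGradedCompl_of_isDegreeCompatible {I : Ideal (Poly K n)} {O : Finset (Mon n)}
    (hdeg : IsDegreeCompatible I O)
    (hdisj : Disjoint (I.restrictScalars K) (restrictSupport K (O : Set (Mon n)))) :
    IsGradedCompl I O := by
  intro i
  induction i using Nat.strong_induction_on with
  | _ i ih =>
    have hle : restrictSupport K {m : Mon n | m ∈ O ∧ m.degree = i} ≤
        restrictSupport K {m : Mon n | m.degree = i} := restrictSupport_mono K fun _ hm => hm.2
    have hd : Disjoint (lfSpace I i) (restrictSupport K {m : Mon n | m ∈ O ∧ m.degree = i}) := by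
      rw [Submodule.disjoint_def]
      intro w hw hwO
      obtain ⟨q, hqI, hq, rfl⟩ := mem_lfSpace.1 hw
      obtain ⟨r, hrI, hr⟩ := exists_sub_mem_of_graded (fun j hj => (ih j hj).2)
        (p := q - homogeneousComponent i q) (by
          intro m hm
          rw [coeff_sub, coeff_homogeneousComponent] at hm
          split_ifs at hm with hmi
          · simp at hm
          · rw [sub_zero] at hm
            exact lt_of_le_of_ne (hq m hm) hmi)
      have hmem : q - r ∈ restrictSupport K (O : Set (Mon n)) := by
        have : q - r = (q - homogeneousComponent i q - r) + homogeneousComponent i q := by ring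
        rw [this]
        exact Submodule.add_mem _ (restrictSupport_le_mono hr) (restrictSupport_le_mono hwO)
      have hqr := Submodule.disjoint_def.1 hdisj (q - r) (I.sub_mem hqI hrI) hmem
      rw [sub_eq_zero] at hqr
      subst hqr
      ext m
      rw [coeff_homogeneousComponent, coeff_zero]
      split_ifs with hmi
      · by_contra h0
        rw [mem_restrictSupport] at hr
        refine absurd (hr m ?_).2 (by simp [hmi])
        simpa [coeff_homogeneousComponent, hmi] using h0
      · rfl
    refine ⟨hd, ?_⟩
    have h1 := finite_lfSpace I i
    have h2 := finite_restrictSupport_degree (K := K) (n := n) i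
    have h3 := Submodule.finiteDimensional_of_le hle
    have h5 := Submodule.finrank_sup_add_finrank_inf_eq (lfSpace I i)
      (restrictSupport K {m : Mon n | m ∈ O ∧ m.degree = i})
    rw [hd.eq_bot, finrank_bot, finrank_lfSpace] at h5
    have h6 : (Module.finrank K (restrictSupport K {m : Mon n | m ∈ O ∧ m.degree = i}) : ℤ) =
        (Module.finrank K (restrictSupport K {m : Mon n | m.degree = i}) : ℤ) -
          (gradedDim I i : ℤ) := hdeg i
    have h7 : Module.finrank K ↥(lfSpace I i ⊔
        restrictSupport K {m : Mon n | m ∈ O ∧ m.degree = i}) =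
        Module.finrank K (restrictSupport K {m : Mon n | m.degree = i}) := by
      change _ + 0 = _ + Module.finrank K (restrictSupport K {m : Mon n | m ∈ O ∧ m.degree = i})
        at h5
      omega
    exact (Submodule.eq_of_le_of_finrank_eq (sup_le (lfSpace_le I i) hle) h7).ge

/-! ### Border bases -/

theorem mem_border {O : Finset (Mon n)} (hO : O ≠ ∅) {b : Mon n} :
    b ∈ border O ↔ (∃ j : Fin n, ∃ t ∈ O, t + Finsupp.single j 1 = b) ∧ b ∉ O := by
  simp [border, hO]

theorem notMem_of_mem_border {O : Finset (Mon n)} {b : Mon n} (hb : b ∈ border O) : b ∉ O := by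
  by_cases hO : O = ∅
  · simp [hO]
  · exact ((mem_border hO).1 hb).2

theorem add_single_mem_border {O : Finset (Mon n)} {t : Mon n} (ht : t ∈ O) (j : Fin n)
    (h : t + Finsupp.single j 1 ∉ O) : t + Finsupp.single j 1 ∈ border O :=
  (mem_border (Finset.ne_empty_of_mem ht)).2 ⟨⟨j, t, ht, rfl⟩, h⟩

theorem sum_monomial_mem (O : Finset (Mon n)) (a : Mon n → K) :
    ∑ t ∈ O, monomial t (a t) ∈ restrictSupport K (O : Set (Mon n)) :=
  Submodule.sum_mem _ fun _ ht => (monomial_mem_restrictSupport K).2 (Or.inl ht)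

theorem sum_monomial_coeff {O : Finset (Mon n)} {p : Poly K n}
    (hp : p ∈ restrictSupport K (O : Set (Mon n))) : ∑ t ∈ O, monomial t (coeff t p) = p := by
  classical
  ext m
  rw [coeff_sum]
  simp only [coeff_monomial]
  rw [Finset.sum_ite_eq' O m]
  split_ifs with hm
  · rfl
  · by_contra h0
    exact hm (mem_restrictSupport.1 hp m (Ne.symm h0))

theorem exists_normalForm {I : Ideal (Poly K n)} {O : Finset (Mon n)}
    (hc : IsCompl (I.restrictScalars K) (restrictSupport K (O : Set (Mon n)))) (p : Poly K n) :
    ∃ a : Mon n → K, p - ∑ t ∈ O, monomial t (a t) ∈ I := by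
  obtain ⟨q, hq, e, he, hqe⟩ := Submodule.mem_sup.1 (hc.sup_eq_top ▸ Submodule.mem_top (x := p))
  refine ⟨fun t => coeff t e, ?_⟩
  rw [sum_monomial_coeff he, ← hqe, add_sub_cancel_right]
  exact hq

-- The space `N = ⟨G⟩ + ⟨O⟩_K` contains `1` and is closed under multiplication by indeterminates, so
-- it is the whole ring. As `⟨G⟩ ⊆ I` and `I` meets `⟨O⟩_K` trivially, `I = ⟨G⟩`.
open Classical in
theorem isBorderBasis_of_mem {I : Ideal (Poly K n)} {O : Finset (Mon n)} (hO : IsOrderIdeal O)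
    (hc : IsCompl (I.restrictScalars K) (restrictSupport K (O : Set (Mon n))))
    (α : Mon n → Mon n → K)
    (hα : ∀ b ∈ border O, monomial b 1 - ∑ t ∈ O, monomial t (α b t) ∈ I) :
    IsBorderBasis O I ((border O).image fun b => monomial b 1 - ∑ t ∈ O, monomial t (α b t)) := by
  refine ⟨hO, ⟨α, rfl⟩, ?_, hc⟩
  set G := (border O).image fun b => monomial b 1 - ∑ t ∈ O, monomial t (α b t) with hG
  have hle : Ideal.span (G : Set (Poly K n)) ≤ I := by
    rw [Ideal.span_le]
    intro g hg
    obtain ⟨b, hb, rfl⟩ := Finset.mem_image.1 (Finset.mem_coe.1 hg)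
    exact hα b hb
  set N := (Ideal.span (G : Set (Poly K n))).restrictScalars K ⊔
    restrictSupport K (O : Set (Mon n)) with hN
  have hmon : ∀ b, b ∈ border O → (monomial b 1 : Poly K n) ∈ N := by
    intro b hb
    refine Submodule.mem_sup.2 ⟨_, ?_, _, sum_monomial_mem O (α b), sub_add_cancel _ _⟩
    exact Ideal.subset_span (Finset.mem_coe.2 (Finset.mem_image_of_mem _ hb))
  have hX : ∀ p ∈ N, ∀ j, p * X j ∈ N := by
    intro p hp j
    obtain ⟨q, hq, e, he, rfl⟩ := Submodule.mem_sup.1 hp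
    rw [add_mul]
    refine N.add_mem (Submodule.mem_sup_left (Ideal.mul_mem_right _ _ hq)) ?_
    rw [← sum_monomial_coeff he, Finset.sum_mul]
    refine Submodule.sum_mem _ fun t ht => ?_
    have hmul : (monomial t (coeff t e) : Poly K n) * X j =
        coeff t e • monomial (t + Finsupp.single j 1) 1 := by
      rw [X, monomial_mul, smul_monomial, smul_eq_mul]
    rw [hmul]
    refine N.smul_mem _ ?_
    by_cases htO : t + Finsupp.single j 1 ∈ O
    · exact Submodule.mem_sup_right ((monomial_mem_restrictSupport K).2 (Or.inl htO))
    · exact hmon _ (add_single_mem_border ht j htO)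
  have hone : (1 : Poly K n) ∈ N := by
    -- For empty `O` the convention `∂∅ = {1}` supplies `1`.
    by_cases hO' : O = ∅
    · exact hmon 0 (by simp [border, hO'])
    · obtain ⟨t, ht⟩ := Finset.nonempty_iff_ne_empty.2 hO'
      refine Submodule.mem_sup_right ((monomial_mem_restrictSupport K).2 (Or.inl ?_))
      exact hO t ht 0 zero_le
  have htop : ∀ p : Poly K n, p ∈ N := by
    intro p
    induction p using MvPolynomial.induction_on with
    | C a => rw [← mul_one (C a), C_mul']; exact N.smul_mem _ hone
    | add p q hp hq => exact N.add_mem hp hq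
    | mul_X p j hp => exact hX p hp j
  refine le_antisymm hle fun p hp => ?_
  obtain ⟨q, hq, e, he, rfl⟩ := Submodule.mem_sup.1 (htop p)
  have heI : e ∈ I := by
    have := I.sub_mem hp (hle hq)
    rwa [add_sub_cancel_left] at this
  rw [Submodule.disjoint_def.1 hc.disjoint e heI he, add_zero]
  exact hq

theorem exists_isBorderBasis {I : Ideal (Poly K n)} {O : Finset (Mon n)} (hO : IsOrderIdeal O)
    (hc : IsCompl (I.restrictScalars K) (restrictSupport K (O : Set (Mon n)))) :
    ∃ G, IsBorderBasis O I G := by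
  choose α hα using fun b : Mon n => exists_normalForm hc (monomial b 1)
  exact ⟨_, isBorderBasis_of_mem hO hc α fun b _ => hα b⟩

theorem IsBorderBasis.unique {I : Ideal (Poly K n)} {O : Finset (Mon n)}
    {G G' : Finset (Poly K n)} (h : IsBorderBasis O I G) (h' : IsBorderBasis O I G') :
    G' = G := by
  classical
  obtain ⟨α, hα⟩ := h.form
  obtain ⟨β, hβ⟩ := h'.form
  rw [hα, hβ]
  refine Finset.image_congr fun b hb => ?_
  have h1 : monomial b 1 - ∑ t ∈ O, monomial t (α b t) ∈ I := by
    rw [← h.span_eq, hα]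
    exact Ideal.subset_span (Finset.mem_coe.2 (Finset.mem_image_of_mem _ hb))
  have h2 : monomial b 1 - ∑ t ∈ O, monomial t (β b t) ∈ I := by
    rw [← h'.span_eq, hβ]
    exact Ideal.subset_span (Finset.mem_coe.2 (Finset.mem_image_of_mem _ hb))
  have h3 := I.sub_mem h1 h2
  rw [sub_sub_sub_cancel_left] at h3
  have h4 := Submodule.disjoint_def.1 h.isCompl.disjoint _ h3
    (Submodule.sub_mem _ (sum_monomial_mem O _) (sum_monomial_mem O _))
  rw [sub_eq_zero.1 h4]

/-- The border basis matters only through the complement it provides: disjointness from `I` one way,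
existence from the complement the other way. -/
theorem mem_Lam_iff {I : Ideal (Poly K n)} {O : Finset (Mon n)} :
    O ∈ Lam I ↔ IsOrderIdeal O ∧ IsGradedCompl I O := by
  constructor
  · rintro ⟨hO, hd, G, hG⟩
    exact ⟨hO, isGradedCompl_of_isDegreeCompatible hd hG.isCompl.disjoint⟩
  · rintro ⟨hO, h⟩
    exact ⟨hO, h.isDegreeCompatible, exists_isBorderBasis hO h.isCompl⟩

/-! ### Stable spans -/

/-- The space `U + U x_1 + … + U x_n`. -/
def nbhd (U : Submodule K (Poly K n)) : Submodule K (Poly K n) :=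
  U ⊔ ⨆ j : Fin n, U.map (LinearMap.mulRight K (X j : Poly K n))

theorem mul_X_mem_nbhd {U : Submodule K (Poly K n)} {p : Poly K n} (hp : p ∈ U) (j : Fin n) :
    p * X j ∈ nbhd U :=
  Submodule.mem_sup_right (Submodule.mem_iSup_of_mem j ⟨p, hp, rfl⟩)

/-- The polynomials of degree at most `d`. -/
abbrev polyLE (K : Type*) [Field K] (n d : ℕ) : Submodule K (Poly K n) :=
  restrictSupport K {m : Mon n | m.degree ≤ d}

/-- The polynomials of degree less than `d`. -/
abbrev polyLT (K : Type*) [Field K] (n d : ℕ) : Submodule K (Poly K n) :=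
  restrictSupport K {m : Mon n | m.degree < d}

theorem polyLT_le_polyLE (d : ℕ) : polyLT K n d ≤ polyLE K n d :=
  restrictSupport_mono K fun m (hm : m.degree < d) => show m.degree ≤ d from hm.le

theorem mul_X_mem_restrictSupport {s t : Set (Mon n)} {j : Fin n}
    (h : ∀ m ∈ s, m + Finsupp.single j 1 ∈ t) {p : Poly K n} (hp : p ∈ restrictSupport K s) :
    p * X j ∈ restrictSupport K t := by
  rw [mem_restrictSupport] at hp ⊢
  intro m hm
  rw [coeff_mul_X'] at hm
  split_ifs at hm with hj
  · have := h _ (hp _ hm)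
    rwa [tsub_add_cancel_of_le] at this
    rw [Finsupp.single_le_iff]
    exact Nat.one_le_iff_ne_zero.2 (Finsupp.mem_support_iff.1 hj)
  · exact absurd rfl hm

theorem degree_add_single (m : Mon n) (j : Fin n) :
    (m + Finsupp.single j 1).degree = m.degree + 1 := by
  rw [map_add, Finsupp.degree_single]

theorem mul_X_mem_polyLE {d : ℕ} {p : Poly K n} (hp : p ∈ polyLT K n d) (j : Fin n) :
    p * X j ∈ polyLE K n d :=
  mul_X_mem_restrictSupport (fun m hm => by
    have h : m.degree < d := hm
    have := degree_add_single m j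
    change (m + Finsupp.single j 1).degree ≤ d
    omega) hp

/-- A subspace of the polynomials of degree at most `d` that is closed under those products with
indeterminates, and sums of these, whose degree does not exceed `d`. -/
structure IsStable (d : ℕ) (U : Submodule K (Poly K n)) : Prop where
  le : U ≤ polyLE K n d
  stable : nbhd U ⊓ polyLE K n d ≤ U

/-- A linear choice of representatives in `T` modulo `U`: a section of the map from `T` onto its
image in the quotient by `U`, extended to the whole quotient. -/
theorem exists_projection {U S T : Submodule K (Poly K n)} (hST : S ≤ U ⊔ T) :
    ∃ π : Poly K n →ₗ[K] Poly K n, (∀ p, π p ∈ T) ∧ (∀ p ∈ U, π p = 0) ∧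
      ∀ p ∈ S, p - π p ∈ U := by
  let f : T →ₗ[K] (Poly K n ⧸ U) := U.mkQ ∘ₗ T.subtype
  obtain ⟨s, hs⟩ := LinearMap.exists_rightInverse_of_surjective f.rangeRestrict
    f.range_rangeRestrict
  obtain ⟨g, hg⟩ := LinearMap.exists_extend s
  refine ⟨T.subtype ∘ₗ g ∘ₗ U.mkQ, fun p => (g (U.mkQ p)).2, fun p hp => ?_, fun p hp => ?_⟩
  · have : U.mkQ p = 0 := by simpa using hp
    simp [this]
  · obtain ⟨u, hu, t, ht, rfl⟩ := Submodule.mem_sup.1 (hST hp)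
    have h1 : U.mkQ (u + t) = f.rangeRestrict ⟨t, ht⟩ := by
      have : U.mkQ u = 0 := by simpa using hu
      rw [map_add, this, zero_add]
      rfl
    have h2 : g (U.mkQ (u + t)) = s (f.rangeRestrict ⟨t, ht⟩) := by
      rw [h1, ← hg]
      rfl
    have h3 : U.mkQ (g (U.mkQ (u + t)) : Poly K n) = U.mkQ (u + t) := by
      have h4 := congrArg Subtype.val (LinearMap.congr_fun hs (f.rangeRestrict ⟨t, ht⟩))
      rw [h2, h1]
      exact h4
    have h5 := (Submodule.Quotient.eq U).1 h3.symm
    exact h5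

open scoped IsMulCommutative in
/-- If modulo the stable space `U` every term of degree `d` is congruent to a polynomial of smaller
degree, then `U` contains all elements of degree at most `d` of the ideal generated by a subset
of `U`. -/
theorem IsStable.mem_of_mem_span {d : ℕ} {U : Submodule K (Poly K n)} (hU : IsStable d U)
    (htop : polyLE K n d ≤ U ⊔ polyLT K n d) {F : Set (Poly K n)} (hF : ∀ f ∈ F, f ∈ U)
    {p : Poly K n} (hp : p ∈ Ideal.span F) (hpd : p ∈ polyLE K n d) : p ∈ U := by
  obtain ⟨π, hπT, hπU, hπ⟩ := exists_projection htop
  have hππ : ∀ p ∈ polyLE K n d, π (π p) = π p := fun p hp => by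
    have := hπU _ (hπ p hp)
    rw [map_sub, sub_eq_zero] at this
    exact this.symm
  have key : ∀ u v i j, u ∈ U → v ∈ U → u * X i - v * X j ∈ polyLE K n d →
      π (u * X i - v * X j) = 0 := fun u v i j hu hv h =>
    hπU _ (hU.stable ⟨Submodule.sub_mem _ (mul_X_mem_nbhd hu i) (mul_X_mem_nbhd hv j), h⟩)
  -- The operator "multiply by `x_j` and take the representative". The inner `π` makes it an
  -- endomorphism of the whole ring.
  let M : Fin n → Module.End K (Poly K n) := fun j => π ∘ₗ LinearMap.mulRight K (X j) ∘ₗ π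
  have hM : ∀ j p, M j p = π (π p * X j) := fun _ _ => rfl
  have hcomm : ∀ i j, M i * M j = M j * M i := by
    intro i j
    refine LinearMap.ext fun p => ?_
    change M i (M j p) = M j (M i p)
    have hi := mul_X_mem_polyLE (hπT p) i
    have hj := mul_X_mem_polyLE (hπT p) j
    rw [hM, hM, hM, hM, hππ _ hi, hππ _ hj, ← sub_eq_zero, ← map_sub]
    -- The right side is a difference of elements of `U` times indeterminates. Its two products
    -- alone might have degree `d + 1`, but the left side shows that the difference has degree at
    -- most `d`, so stability applies.
    have h1 : π (π p * X j) * X i - π (π p * X i) * X j =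
        (π p * X i - π (π p * X i)) * X j - (π p * X j - π (π p * X j)) * X i := by ring
    rw [h1]
    refine key _ _ _ _ (hπ _ hi) (hπ _ hj) ?_
    rw [← h1]
    exact Submodule.sub_mem _ (mul_X_mem_polyLE (hπT _) i) (mul_X_mem_polyLE (hπT _) j)
  have hcomm' : ∀ a ∈ Set.range M, ∀ b ∈ Set.range M, a * b = b * a := by
    rintro _ ⟨i, rfl⟩ _ ⟨j, rfl⟩
    exact hcomm i j
  have := Algebra.isMulCommutative_adjoin K hcomm'
  -- Commutativity permits evaluating polynomials at the operators. The map `q ↦ φ q (π 1)` agrees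
  -- with `π` in degree at most `d` (`hlow`) and vanishes on the ideal (`hideal`), so `π p = 0`.
  let φ : Poly K n →ₐ[K] Algebra.adjoin K (Set.range M) :=
    aeval fun j => ⟨M j, Algebra.subset_adjoin ⟨j, rfl⟩⟩
  have hφmul : ∀ p q : Poly K n, (φ (p * q)).1 (π 1) = (φ p).1 ((φ q).1 (π 1)) := by
    intro p q
    rw [map_mul]
    rfl
  have hφadd : ∀ p q : Poly K n, (φ (p + q)).1 (π 1) = (φ p).1 (π 1) + (φ q).1 (π 1) := by
    intro p q
    rw [map_add]
    rfl
  have hφX : ∀ (p : Poly K n) (j : Fin n), (φ (p * X j)).1 (π 1) = M j ((φ p).1 (π 1)) := by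
    intro p j
    rw [mul_comm, hφmul]
    simp [φ]
  have hmon : ∀ (k : ℕ) (m : Mon n), m.degree = k → k ≤ d →
      (φ (monomial m 1)).1 (π 1) = π (monomial m 1) := by
    intro k
    induction k with
    | zero =>
      intro m hm _
      rw [Finsupp.degree_eq_zero_iff] at hm
      subst hm
      change (φ 1).1 (π 1) = π 1
      rw [map_one]
      rfl
    | succ k ih =>
      intro m hm hk
      obtain ⟨j, hj⟩ : ∃ j, m j ≠ 0 := by
        by_contra! h0
        have : m = 0 := Finsupp.ext h0
        simp [this] at hm
      have hle : Finsupp.single j 1 ≤ m := by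
        rw [Finsupp.single_le_iff]
        exact Nat.one_le_iff_ne_zero.2 hj
      obtain ⟨m', rfl⟩ : ∃ m', m = m' + Finsupp.single j 1 := ⟨_, (tsub_add_cancel_of_le hle).symm⟩
      rw [degree_add_single] at hm
      have hm' : m'.degree = k := by omega
      have hmul : (monomial (m' + Finsupp.single j 1) 1 : Poly K n) = monomial m' 1 * X j := by
        rw [X, monomial_mul, one_mul]
      have hlt : (monomial m' 1 : Poly K n) ∈ polyLT K n d :=
        (monomial_mem_restrictSupport K).2 (Or.inl (show m'.degree < d by omega))
      rw [hmul, hφX, ih m' hm' (by omega), hM, hππ _ (polyLT_le_polyLE d hlt), ← sub_eq_zero,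
        ← map_sub, ← sub_mul]
      refine hπU _ (hU.stable ⟨?_, ?_⟩)
      · rw [← neg_sub, neg_mul]
        exact Submodule.neg_mem _ (mul_X_mem_nbhd (hπ _ (polyLT_le_polyLE d hlt)) j)
      · exact mul_X_mem_polyLE (Submodule.sub_mem _ (hπT _) hlt) j
  have hlow : ∀ q ∈ polyLE K n d, (φ q).1 (π 1) = π q := by
    intro q hq
    rw [polyLE, restrictSupport_eq_span] at hq
    induction hq using Submodule.span_induction with
    | mem x hx =>
      obtain ⟨m, hm, rfl⟩ := hx
      exact hmon _ m rfl hm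
    | zero => simp
    | add x y _ _ hx hy =>
      rw [hφadd, hx, hy, map_add]
    | smul a x _ hx =>
      rw [map_smul, map_smul, ← hx]
      rfl
  have hideal : (φ p).1 (π 1) = 0 := by
    clear hpd
    induction hp using Submodule.span_induction with
    | mem x hx => rw [hlow x (hU.le (hF x hx)), hπU x (hF x hx)]
    | zero => simp
    | add x y _ _ hx hy =>
      rw [hφadd, hx, hy, add_zero]
    | smul a x _ hx =>
      rw [smul_eq_mul, hφmul, hx, map_zero]
  have := hπ p hpd
  rwa [← hlow p hpd, hideal, sub_zero] at this

/-! ### Leading terms with respect to a degree-compatible term ordering -/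

theorem IsDegreeOrder.degree_le {σ : MonomialOrder (Fin n)} (hσ : IsDegreeOrder σ) {a b : Mon n}
    (h : σ.toSyn a ≤ σ.toSyn b) : a.degree ≤ b.degree := by
  by_contra! hlt
  exact absurd (hσ b a hlt) (not_lt.2 h)

theorem IsDegreeOrder.le_degree {σ : MonomialOrder (Fin n)} (hσ : IsDegreeOrder σ) {p : Poly K n}
    {m : Mon n} (hm : coeff m p ≠ 0) : m.degree ≤ (σ.degree p).degree :=
  hσ.degree_le (σ.le_degree (mem_support_iff.2 hm))

theorem IsDegreeOrder.totalDegree_eq {σ : MonomialOrder (Fin n)} (hσ : IsDegreeOrder σ)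
    (p : Poly K n) : p.totalDegree = (σ.degree p).degree := by
  by_cases hp : p = 0
  · simp [hp]
  · refine le_antisymm ?_ (le_totalDegree (σ.degree_mem_support hp))
    exact Finset.sup_le fun m hm => hσ.le_degree (mem_support_iff.1 hm)

/-- A subspace contains all polynomials supported in `S` if it contains, for every term of `S`, a
polynomial supported in `S` with this leading term. -/
theorem restrictSupport_le_of_degree (σ : MonomialOrder (Fin n)) {S : Set (Mon n)}
    {N : Submodule K (Poly K n)}
    (h : ∀ t ∈ S, ∃ u ∈ N, u ≠ 0 ∧ σ.degree u = t ∧ u ∈ restrictSupport K S) :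
    restrictSupport K S ≤ N := by
  suffices H : ∀ (t : σ.syn) (p : Poly K n), p ∈ restrictSupport K S →
      σ.toSyn (σ.degree p) = t → p ∈ N from fun p hp => H _ p hp rfl
  intro t
  induction t using WellFoundedLT.induction with
  | _ t ih =>
    intro p hp hpt
    by_cases hp0 : p = 0
    · rw [hp0]
      exact N.zero_mem
    obtain ⟨u, hu, hu0, hut, huS⟩ := h (σ.degree p)
      (mem_restrictSupport.1 hp _ (σ.coeff_degree_ne_zero_iff.2 hp0))
    set c := coeff (σ.degree p) p / coeff (σ.degree p) u with hc
    have hcoeff : coeff (σ.degree p) u ≠ 0 := by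
      rw [← hut]
      exact σ.coeff_degree_ne_zero_iff.2 hu0
    have hcancel : coeff (σ.degree p) (p - c • u) = 0 := by
      rw [coeff_sub, coeff_smul, smul_eq_mul, hc, div_mul_cancel₀ _ hcoeff, sub_self]
    have hsub : p - c • u ∈ N := by
      by_cases h0 : p - c • u = 0
      · rw [h0]
        exact N.zero_mem
      refine ih _ ?_ (p - c • u) (Submodule.sub_mem _ hp (Submodule.smul_mem _ _ huS)) rfl
      rw [← hpt]
      have hne : σ.degree (p - c • u) ≠ σ.degree p := fun he =>
        σ.coeff_degree_ne_zero_iff.2 h0 (he ▸ hcancel)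
      refine lt_of_le_of_ne ?_ fun he => hne (σ.toSyn.injective he)
      refine σ.degree_sub_le.trans (sup_le le_rfl ?_)
      exact σ.degree_smul_le.trans (by rw [hut])
    have := N.add_mem hsub (N.smul_mem c hu)
    rwa [sub_add_cancel] at this

/-- The leading terms of an ideal. -/
def ltSet (σ : MonomialOrder (Fin n)) (I : Ideal (Poly K n)) : Set (Mon n) :=
  {t | ∃ p ∈ I, p ≠ 0 ∧ σ.degree p = t}

theorem ltSet_mono {σ : MonomialOrder (Fin n)} {I : Ideal (Poly K n)} {s t : Mon n} (h : s ≤ t)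
    (hs : s ∈ ltSet σ I) : t ∈ ltSet σ I := by
  obtain ⟨p, hp, hp0, rfl⟩ := hs
  have h1 : (monomial (t - σ.degree p) 1 : Poly K n) ≠ 0 := by simp
  refine ⟨monomial (t - σ.degree p) 1 * p, I.mul_mem_left _ hp, mul_ne_zero h1 hp0, ?_⟩
  classical
  rw [σ.degree_mul h1 hp0, σ.degree_monomial, if_neg one_ne_zero, tsub_add_cancel_of_le h]

/-- A nonzero polynomial without leading terms of `I` in its support is not in `I`, so these
polynomials embed into the finite-dimensional quotient. -/
theorem finite_compl_ltSet (σ : MonomialOrder (Fin n)) {I : Ideal (Poly K n)}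
    (hI : Module.Finite K (Poly K n ⧸ I)) : (ltSet σ I)ᶜ.Finite := by
  let f : restrictSupport K (ltSet σ I)ᶜ →ₗ[K] (Poly K n ⧸ I) :=
    (Ideal.Quotient.mkₐ K I).toLinearMap ∘ₗ (restrictSupport K (ltSet σ I)ᶜ).subtype
  have hf : Function.Injective f := by
    rw [injective_iff_map_eq_zero]
    rintro ⟨p, hp⟩ h
    have hpI : p ∈ I := Ideal.Quotient.eq_zero_iff_mem.1 h
    by_contra h0
    have hp0 : p ≠ 0 := fun h => h0 (by simp [h])
    exact mem_restrictSupport.1 hp _ (σ.coeff_degree_ne_zero_iff.2 hp0) ⟨p, hpI, hp0, rfl⟩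
  have := Module.Finite.of_injective f hf
  have := Module.Finite.finite_basis (basisRestrictSupport K (ltSet σ I)ᶜ)
  exact Set.toFinite _

theorem exists_degree_le_mem_ltSet (σ : MonomialOrder (Fin n)) {I : Ideal (Poly K n)}
    (hI : Module.Finite K (Poly K n ⧸ I)) : ∃ D : ℕ, ∀ t : Mon n, D ≤ t.degree → t ∈ ltSet σ I := by
  refine ⟨(finite_compl_ltSet σ hI).toFinset.sup Finsupp.degree + 1, fun t ht => ?_⟩
  by_contra h
  have : t.degree ≤ (finite_compl_ltSet σ hI).toFinset.sup Finsupp.degree :=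
    Finset.le_sup (f := Finsupp.degree) ((finite_compl_ltSet σ hI).mem_toFinset.2 h)
  omega

/-- For a degree-compatible ordering the leading term sits in the component of highest degree, so
passing to that component keeps it. -/
theorem exists_mem_lfSpace {σ : MonomialOrder (Fin n)} (hσ : IsDegreeOrder σ)
    {I : Ideal (Poly K n)} {t : Mon n} (htI : t ∈ ltSet σ I) {i : ℕ} (ht : t.degree = i) :
    ∃ u ∈ lfSpace I i, u ≠ 0 ∧ σ.degree u = t := by
  obtain ⟨q, hqI, hq0, rfl⟩ := htI
  have hcoeff : coeff (σ.degree q) (homogeneousComponent i q) ≠ 0 := by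
    rw [coeff_homogeneousComponent, if_pos ht]
    exact σ.coeff_degree_ne_zero_iff.2 hq0
  refine ⟨homogeneousComponent i q, mem_lfSpace.2 ⟨q, hqI, fun m hm => ht ▸ hσ.le_degree hm, rfl⟩,
    fun h => hcoeff (by simp [h]), ?_⟩
  refine σ.toSyn.injective (le_antisymm ?_ (σ.le_degree (mem_support_iff.2 hcoeff)))
  rw [σ.degree_le_iff]
  intro m hm
  rw [mem_support_iff, coeff_homogeneousComponent] at hm
  split_ifs at hm
  · exact σ.le_degree (mem_support_iff.2 hm)
  · exact absurd rfl hm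

/-- The terms that are no leading terms form an element of `Λ(I)`. -/
theorem exists_mem_Lam {σ : MonomialOrder (Fin n)} (hσ : IsDegreeOrder σ) {I : Ideal (Poly K n)}
    (hI : Module.Finite K (Poly K n ⧸ I)) : ∃ O, O ∈ Lam I := by
  have hfin := finite_compl_ltSet σ hI
  have hmem : ∀ t, t ∈ hfin.toFinset ↔ t ∉ ltSet σ I := fun t => hfin.mem_toFinset
  refine ⟨hfin.toFinset, mem_Lam_iff.2 ⟨fun t ht s hs => ?_, fun i => ⟨?_, ?_⟩⟩⟩
  · rw [hmem] at ht ⊢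
    exact fun h => ht (ltSet_mono hs h)
  · rw [Submodule.disjoint_def]
    intro w hw hwO
    obtain ⟨q, hqI, hq, rfl⟩ := mem_lfSpace.1 hw
    by_contra h0
    obtain ⟨m, hm⟩ := MvPolynomial.ne_zero_iff.1 h0
    rw [coeff_homogeneousComponent] at hm
    split_ifs at hm with hmi
    · have hq0 : q ≠ 0 := by rintro rfl; simp at hm
      have hlc := σ.coeff_degree_ne_zero_iff.2 hq0
      have hdeg : (σ.degree q).degree = i :=
        le_antisymm (hq _ hlc) (hmi ▸ hσ.le_degree hm)
      refine (hmem _).1 (mem_restrictSupport.1 hwO (σ.degree q) ?_).1 ⟨q, hqI, hq0, rfl⟩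
      rwa [coeff_homogeneousComponent, if_pos hdeg]
    · exact hm rfl
  · refine restrictSupport_le_of_degree σ fun t ht => ?_
    by_cases htI : t ∈ ltSet σ I
    · obtain ⟨u, hu, hu0, hut⟩ := exists_mem_lfSpace hσ htI ht
      exact ⟨u, Submodule.mem_sup_left hu, hu0, hut, lfSpace_le I i hu⟩
    · classical
      refine ⟨monomial t 1, Submodule.mem_sup_right ((monomial_mem_restrictSupport K).2
        (Or.inl ⟨(hmem t).2 htI, ht⟩)), by simp, ?_, (monomial_mem_restrictSupport K).2 (Or.inl ht)⟩
      rw [σ.degree_monomial, if_neg one_ne_zero]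

/-! ### Stable spans in large degree -/

/-- Every polynomial of degree at most `d` is congruent modulo `U` to one of smaller degree if every
term of degree `d` is the leading term of an element of `U`. -/
theorem polyLE_le_sup (σ : MonomialOrder (Fin n)) {d : ℕ} {U : Submodule K (Poly K n)}
    (hU : U ≤ polyLE K n d)
    (h : ∀ t : Mon n, t.degree = d → ∃ u ∈ U, u ≠ 0 ∧ σ.degree u = t) :
    polyLE K n d ≤ U ⊔ polyLT K n d := by
  refine restrictSupport_le_of_degree σ fun t ht => ?_
  have htd : t.degree ≤ d := ht
  rcases htd.eq_or_lt with htd' | htd'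
  · obtain ⟨u, hu, hu0, hut⟩ := h t htd'
    exact ⟨u, Submodule.mem_sup_left hu, hu0, hut, hU hu⟩
  · classical
    refine ⟨monomial t 1, Submodule.mem_sup_right ((monomial_mem_restrictSupport K).2
      (Or.inl htd')), by simp, ?_, (monomial_mem_restrictSupport K).2 (Or.inl ht)⟩
    rw [σ.degree_monomial, if_neg one_ne_zero]

/-- A representation of `p` by elements of `F` is built from finitely many products with
indeterminates; once `d` bounds all their degrees, stability carries the construction out inside
`U`. The bound does not depend on `U`. -/
theorem exists_forall_isStable_mem {F : Set (Poly K n)} {p : Poly K n} (hp : p ∈ Ideal.span F) :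
    ∃ d₀, ∀ d ≥ d₀, ∀ U : Submodule K (Poly K n), IsStable d U → (∀ f ∈ F, f ∈ U) → p ∈ U := by
  induction hp using Submodule.span_induction with
  | mem f hf => exact ⟨0, fun _ _ _ _ h => h f hf⟩
  | zero => exact ⟨0, fun _ _ U _ _ => U.zero_mem⟩
  | add p q _ _ hp hq =>
    obtain ⟨d₁, h₁⟩ := hp
    obtain ⟨d₂, h₂⟩ := hq
    exact ⟨max d₁ d₂, fun d hd U hU hF => U.add_mem (h₁ d (le_of_max_le_left hd) U hU hF)
      (h₂ d (le_of_max_le_right hd) U hU hF)⟩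
  | smul q p _ hp =>
    rw [smul_eq_mul]
    induction q using MvPolynomial.induction_on with
    | C a =>
      obtain ⟨d₁, h₁⟩ := hp
      refine ⟨d₁, fun d hd U hU hF => ?_⟩
      rw [C_mul']
      exact U.smul_mem _ (h₁ d hd U hU hF)
    | add q r hq hr =>
      obtain ⟨d₁, h₁⟩ := hq
      obtain ⟨d₂, h₂⟩ := hr
      refine ⟨max d₁ d₂, fun d hd U hU hF => ?_⟩
      rw [add_mul]
      exact U.add_mem (h₁ d (le_of_max_le_left hd) U hU hF)
        (h₂ d (le_of_max_le_right hd) U hU hF)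
    | mul_X q j hq =>
      obtain ⟨d₁, h₁⟩ := hq
      refine ⟨max d₁ ((q * p) * X j).totalDegree, fun d hd U hU hF => ?_⟩
      have hmul : q * X j * p = q * p * X j := by ring
      rw [hmul]
      refine hU.stable ⟨mul_X_mem_nbhd (h₁ d (le_of_max_le_left hd) U hU hF) j, ?_⟩
      exact mem_restrictSupport.2 fun m hm =>
        (le_totalDegree (mem_support_iff.2 hm)).trans (le_of_max_le_right hd)

/-- This bounds the main loop. For some `D` all terms of degree at least `D` are leading terms of
`I`. The finitely many certificates for degree exactly `D` fit into `U`, and multiplying by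
indeterminates climbs from `D` to `d` without exceeding degree `d`. -/
theorem exists_forall_isStable_degree {σ : MonomialOrder (Fin n)} (hσ : IsDegreeOrder σ)
    {F : Set (Poly K n)} (hI : Module.Finite K (Poly K n ⧸ Ideal.span F)) :
    ∃ D₀, ∀ d ≥ D₀, ∀ U : Submodule K (Poly K n), IsStable d U → (∀ f ∈ F, f ∈ U) →
      ∀ t : Mon n, t.degree = d → ∃ u ∈ U, u ≠ 0 ∧ σ.degree u = t := by
  obtain ⟨D, hD⟩ := exists_degree_le_mem_ltSet σ hI
  choose! p hpI hp0 hpt using hD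
  choose! d₀ hd₀ using fun t (ht : D ≤ t.degree) => exists_forall_isStable_mem (hpI t ht)
  have hfin : {t : Mon n | t.degree = D}.Finite := Finsupp.finite_of_degree_eq D
  refine ⟨max D (hfin.toFinset.sup d₀), fun d hd U hU hF => ?_⟩
  suffices H : ∀ k, D ≤ k → k ≤ d → ∀ t : Mon n, t.degree = k →
      ∃ u ∈ U, u ≠ 0 ∧ σ.degree u = t from H d (le_of_max_le_left hd) le_rfl
  intro k hk
  induction k, hk using Nat.le_induction with
  | base =>
    intro _ t ht
    refine ⟨p t, hd₀ t ht.ge d ?_ U hU hF, hp0 t ht.ge, hpt t ht.ge⟩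
    exact (Finset.le_sup (f := d₀) (hfin.mem_toFinset.2 ht)).trans (le_of_max_le_right hd)
  | succ k _ ih =>
    intro hkd t ht
    obtain ⟨s, hst, hs⟩ := Finsupp.exists_le_degree_eq t k (by omega)
    obtain ⟨r, rfl⟩ := exists_add_of_le hst
    have hr : r.degree = 1 := by
      rw [map_add] at ht
      omega
    obtain ⟨j, rfl⟩ : r ∈ Set.range fun j : Fin n => Finsupp.single j 1 := by
      rw [Finsupp.range_single_one]
      exact hr
    obtain ⟨u, hu, hu0, rfl⟩ := ih (by omega) s hs
    have hX : (X j : Poly K n) ≠ 0 := X_ne_zero j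
    have hdeg : σ.degree (u * X j) = σ.degree u + Finsupp.single j 1 := by
      rw [σ.degree_mul hu0 hX, σ.degree_X]
    refine ⟨u * X j, hU.stable ⟨mul_X_mem_nbhd hu j, mem_restrictSupport.2 fun m hm => ?_⟩,
      mul_ne_zero hu0 hX, hdeg⟩
    have := hσ.le_degree hm
    rw [hdeg] at this
    exact this.trans (ht.trans_le hkd)

/-! ### The integral points of the order ideal polytope -/

/-- `V` is a basis of the elements of `I` of degree at most `d` with distinct leading terms, among
them all terms of degree `d`. -/
structure IsDegreeBasis (σ : MonomialOrder (Fin n)) (I : Ideal (Poly K n)) (d : ℕ)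
    (V : List (Poly K n)) : Prop where
  echelon : IsEchelon ⊤ σ.degree V
  mem_iff : ∀ p, p ∈ listSpan V ↔ p ∈ I ∧ p ∈ polyLE K n d
  top : ∀ t : Mon n, t.degree = d → ∃ v ∈ V, σ.degree v = t

/-- An element of the span of `V` lies in the span of the elements of `V` of no larger degree. -/
theorem IsEchelon.mem_span_degree_le {σ : MonomialOrder (Fin n)} (hσ : IsDegreeOrder σ)
    {V : List (Poly K n)} (hV : IsEchelon ⊤ σ.degree V) {p : Poly K n} (hp : p ∈ listSpan V)
    {i : ℕ} (hpi : p ∈ polyLE K n i) :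
    p ∈ Submodule.span K {w | w ∈ V ∧ w.totalDegree ≤ i} := by
  by_cases hp0 : p = 0
  · rw [hp0]
    exact Submodule.zero_mem _
  obtain ⟨v, -, -, hmem⟩ := (isLeadFun_degree σ).exists_lead_eq hV hp hp0
  refine Submodule.span_mono (fun w hw => ?_) hmem
  refine ⟨hw.1, ?_⟩
  rw [hσ.totalDegree_eq]
  exact (hσ.degree_le (not_lt.1 hw.2)).trans
    (mem_restrictSupport.1 hpi _ (σ.coeff_degree_ne_zero_iff.2 hp0))

namespace IsDegreeBasis

variable {σ : MonomialOrder (Fin n)} {I : Ideal (Poly K n)} {d : ℕ} {V : List (Poly K n)}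

/-- An element of `I^{≤ i}` is a combination of members of `V` of degree at most `i`. Taking
components of degree `i` removes those of lower degree and turns the others into their leading
forms. -/
theorem span_leadingForm (h : IsDegreeBasis σ I d V) (hσ : IsDegreeOrder σ) {i : ℕ} (hi : i ≤ d) :
    Submodule.span K (leadingForm '' degPart V i) = lfSpace I i := by
  apply le_antisymm
  · rw [Submodule.span_le]
    rintro _ ⟨v, ⟨hv, rfl⟩, rfl⟩
    exact mem_lfSpace.2 ⟨v, ((h.mem_iff v).1 (mem_listSpan hv)).1,
      fun m hm => le_totalDegree (mem_support_iff.2 hm), rfl⟩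
  · intro w hw
    obtain ⟨q, hqI, hq, rfl⟩ := mem_lfSpace.1 hw
    have hqV : q ∈ listSpan V :=
      (h.mem_iff q).2 ⟨hqI, mem_restrictSupport.2 fun m hm => (hq m hm).trans hi⟩
    have hmem := h.echelon.mem_span_degree_le hσ hqV (mem_restrictSupport.2 hq)
    have hle : Submodule.span K {w | w ∈ V ∧ w.totalDegree ≤ i} ≤
        (Submodule.span K (leadingForm '' degPart V i)).comap (homogeneousComponent i) := by
      rw [Submodule.span_le]
      rintro v ⟨hv, hvi⟩
      rw [SetLike.mem_coe, Submodule.mem_comap]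
      rcases hvi.eq_or_lt with hvi | hvi
      · exact Submodule.subset_span ⟨v, ⟨hv, hvi⟩, by rw [leadingForm, hvi]⟩
      · rw [homogeneousComponent_eq_zero _ _ hvi]
        exact Submodule.zero_mem _
    exact hle hmem

theorem lfDim_eq (h : IsDegreeBasis σ I d V) (hσ : IsDegreeOrder σ) {i : ℕ} (hi : i ≤ d) :
    lfDim V i = Module.finrank K (lfSpace I i) := by
  rw [lfDim, h.span_leadingForm hσ hi]

/-- Every term of degree at least `d` is a multiple of a leading term of degree `d`. In particular
elements of `Λ(I)` live in degrees below `d`. -/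
theorem le_lfSpace (h : IsDegreeBasis σ I d V) (hσ : IsDegreeOrder σ) {i : ℕ} (hi : d ≤ i) :
    restrictSupport K {m : Mon n | m.degree = i} ≤ lfSpace I i := by
  refine restrictSupport_le_of_degree σ fun t ht => ?_
  have htd : t.degree = i := ht
  obtain ⟨s, hst, hs⟩ := Finsupp.exists_le_degree_eq t d (by omega)
  obtain ⟨v, hv, rfl⟩ := h.top s hs
  have htI : t ∈ ltSet σ I := ltSet_mono hst
    ⟨v, ((h.mem_iff v).1 (mem_listSpan hv)).1, h.echelon.ne_zero hv, rfl⟩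
  obtain ⟨u, hu, hu0, hut⟩ := exists_mem_lfSpace hσ htI htd
  exact ⟨u, hu, hu0, hut, lfSpace_le I i hu⟩

theorem degree_lt (h : IsDegreeBasis σ I d V) (hσ : IsDegreeOrder σ) {O : Finset (Mon n)}
    (hO : IsGradedCompl I O) {m : Mon n} (hm : m ∈ O) : m.degree < d := by
  by_contra! hd
  have h1 : (monomial m 1 : Poly K n) ∈ restrictSupport K {t : Mon n | t.degree = m.degree} :=
    (monomial_mem_restrictSupport K).2 (Or.inl rfl)
  have h2 := Submodule.disjoint_def.1 (hO m.degree).1 (monomial m 1) (h.le_lfSpace hσ hd h1)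
    ((monomial_mem_restrictSupport K).2 (Or.inl ⟨hm, rfl⟩))
  simp at h2

end IsDegreeBasis

/-- The coefficients of a polynomial at the terms in `U`. -/
def coeffOn {d : ℕ} (U : Finset ↥(termsLE n d)) : Poly K n →ₗ[K] (↥U → K) where
  toFun p u := coeff u.1.1 p
  map_add' _ _ := rfl
  map_smul' _ _ := rfl

theorem finite_degPart (V : List (Poly K n)) (i : ℕ) : (degPart V i).Finite :=
  (List.finite_toSet V).subset fun _ hv => hv.1

/-- The row space is the image of the span of the leading forms, so the rank depends on that span
only. -/
theorem rank_lfMatrix {d : ℕ} (V : List (Poly K n)) (i : ℕ) (U : Finset ↥(termsLE n d)) :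
    (lfMatrix V i U).rank = Module.finrank K
      ↥((Submodule.span K (leadingForm '' degPart V i)).map (coeffOn (K := K) U)) := by
  have := (finite_degPart V i).to_subtype
  have hrow : Set.range (lfMatrix V i U).row = coeffOn (K := K) U '' (leadingForm '' degPart V i) := by
    ext x
    constructor
    · rintro ⟨v, rfl⟩
      exact ⟨_, ⟨v.1, v.2, rfl⟩, rfl⟩
    · rintro ⟨_, ⟨v, hv, rfl⟩, rfl⟩
      exact ⟨⟨v, hv⟩, rfl⟩
  rw [Matrix.rank_eq_finrank_span_row, Submodule.map_span, hrow]

open Classical in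
/-- The characteristic function of `O`. -/
def indicatorPoint {d : ℕ} (O : Finset (Mon n)) : ↥(termsLE n d) → ℝ :=
  fun m => if m.1 ∈ O then 1 else 0

theorem orderIdealOf_subset {d : ℕ} (z : ↥(termsLE n d) → ℝ) : orderIdealOf z ⊆ termsLE n d := by
  intro m hm
  simp only [orderIdealOf, Finset.mem_image] at hm
  obtain ⟨m', -, rfl⟩ := hm
  exact m'.2

theorem mem_orderIdealOf {d : ℕ} {z : ↥(termsLE n d) → ℝ} {m : ↥(termsLE n d)} :
    m.1 ∈ orderIdealOf z ↔ z m = 1 := by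
  simp [orderIdealOf]

theorem orderIdealOf_indicatorPoint {d : ℕ} {O : Finset (Mon n)} (hO : O ⊆ termsLE n d) :
    orderIdealOf (indicatorPoint (d := d) O) = O := by
  ext m
  constructor
  · intro hm
    have h := (mem_orderIdealOf (m := ⟨m, orderIdealOf_subset _ hm⟩)).1 hm
    by_contra h0
    simp [indicatorPoint, h0] at h
  · intro hm
    exact (mem_orderIdealOf (m := ⟨m, hO hm⟩)).2 (by simp [indicatorPoint, hm])

theorem indicatorPoint_orderIdealOf {V : List (Poly K n)} {d : ℕ} {z : ↥(termsLE n d) → ℝ}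
    (hz : z ∈ orderIdealPolytope V d) (hint : IsIntegralPoint z) :
    indicatorPoint (orderIdealOf z) = z := by
  funext m
  rw [indicatorPoint]
  split_ifs with hm
  · exact (mem_orderIdealOf.1 hm).symm
  · rw [mem_orderIdealOf] at hm
    obtain ⟨k, hk⟩ := hint m
    obtain ⟨h0, h1⟩ := hz.2.2.2 m
    rw [hk] at h0 h1 hm ⊢
    norm_cast at h0 h1 hm ⊢
    omega

theorem isIntegralPoint_indicatorPoint {d : ℕ} (O : Finset (Mon n)) :
    IsIntegralPoint (indicatorPoint (d := d) O) := by
  intro m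
  rw [indicatorPoint]
  split_ifs
  · exact ⟨1, by simp⟩
  · exact ⟨0, by simp⟩

open Classical in
theorem sum_indicatorPoint {d : ℕ} (O : Finset (Mon n)) (S : Finset ↥(termsLE n d)) :
    ∑ m ∈ S, indicatorPoint O m = ((S.filter fun m => m.1 ∈ O).card : ℝ) := by
  simp [indicatorPoint, Finset.sum_boole]

theorem ncard_setOf_mem_termsLE {d : ℕ} (P : Mon n → Prop) (hP : ∀ m, P m → m ∈ termsLE n d)
    [DecidablePred fun m : ↥(termsLE n d) => P m.1] :
    (Finset.univ.filter fun m : ↥(termsLE n d) => P m.1).card = {m | P m}.ncard := by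
  rw [← Set.ncard_coe_finset, ← Set.ncard_image_of_injective _ Subtype.val_injective]
  congr 1
  ext m
  simp only [Set.mem_image, Finset.coe_filter, Finset.mem_univ, true_and, Set.mem_ofPred_eq,
    Subtype.exists, exists_and_left, exists_prop, exists_eq_right_right]
  exact ⟨fun h => h.1, fun h => ⟨h, hP m h⟩⟩

theorem degree_inter_eq {d i : ℕ} (hi : i ≤ d) :
    {m : Mon n | m ∈ termsLE n d ∧ m.degree = i} = {m : Mon n | m.degree = i} :=
  Set.ext fun _ => and_iff_right_of_imp fun h => mem_termsLE.2 (h.trans_le hi)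

/-- The rank of the leading forms of `I` on `U` is at least the number of terms of `U` outside of an
order ideal that complements the leading forms. -/
theorem card_filter_notMem_le {I : Ideal (Poly K n)} {O : Finset (Mon n)} (h : IsGradedCompl I O)
    {d i : ℕ} {U : Finset ↥(termsLE n d)} (hU : ∀ m ∈ U, m.1.degree = i)
    [DecidablePred fun m : ↥(termsLE n d) => m.1 ∉ O] :
    (U.filter fun m => m.1 ∉ O).card ≤
      Module.finrank K ↥((lfSpace I i).map (coeffOn (K := K) U)) := by
  classical
  let ι := ↥(U.filter fun m => m.1 ∉ O)
  let g : (↥U → K) →ₗ[K] (ι → K) :=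
    LinearMap.funLeft K K fun v => ⟨v.1, (Finset.mem_filter.1 v.2).1⟩
  -- Modulo `⟨O⟩` each term of `U` outside `O` is a leading form, whose restriction to the columns
  -- outside `O` is a unit vector.
  have htop : (((lfSpace I i).map (coeffOn (K := K) U)).map g) = ⊤ := by
    rw [eq_top_iff, ← (Pi.basisFun K ι).span_eq, Submodule.span_le]
    rintro _ ⟨u, rfl⟩
    have hmem : (monomial u.1.1 1 : Poly K n) ∈ restrictSupport K {m : Mon n | m.degree = i} :=
      (monomial_mem_restrictSupport K).2 (Or.inl (hU _ (Finset.mem_filter.1 u.2).1))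
    obtain ⟨w, hw, e, he, hwe⟩ := Submodule.mem_sup.1 ((h i).2 hmem)
    refine ⟨_, ⟨w, hw, rfl⟩, ?_⟩
    funext v
    have hv : coeff v.1.1 e = 0 := by
      by_contra h0
      exact (Finset.mem_filter.1 v.2).2 (mem_restrictSupport.1 he _ h0).1
    have hv' := congrArg (coeff v.1.1) hwe
    rw [coeff_add, hv, add_zero, coeff_monomial] at hv'
    change coeff v.1.1 w = _
    rw [hv', Pi.basisFun_apply, Pi.single_apply]
    refine if_congr ⟨fun h => ?_, fun h => by rw [h]⟩ rfl rfl
    exact (Subtype.ext (Subtype.ext h)).symm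
  rw [← Fintype.card_coe, ← Module.finrank_fintype_fun_eq_card K, ← finrank_top, ← htop]
  exact Submodule.finrank_map_le _ _

namespace IsDegreeBasis

variable {σ : MonomialOrder (Fin n)} {I : Ideal (Poly K n)} {d : ℕ} {V : List (Poly K n)}

theorem finrank_lfSpace_add (i : ℕ) {O : Finset (Mon n)}
    (hd : Disjoint (lfSpace I i) (restrictSupport K {m : Mon n | m ∈ O ∧ m.degree = i})) :
    restrictSupport K {m : Mon n | m.degree = i} ≤
      lfSpace I i ⊔ restrictSupport K {m : Mon n | m ∈ O ∧ m.degree = i} ↔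
    {m : Mon n | m.degree = i}.ncard =
      Module.finrank K (lfSpace I i) + {m : Mon n | m ∈ O ∧ m.degree = i}.ncard := by
  have h1 := finite_lfSpace I i
  have h2 := finite_restrictSupport_degree (K := K) (n := n) i
  have hle : restrictSupport K {m : Mon n | m ∈ O ∧ m.degree = i} ≤
      restrictSupport K {m : Mon n | m.degree = i} := restrictSupport_mono K fun _ hm => hm.2
  have h3 := Submodule.finiteDimensional_of_le hle
  have h5 := Submodule.finrank_sup_add_finrank_inf_eq (lfSpace I i)
    (restrictSupport K {m : Mon n | m ∈ O ∧ m.degree = i})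
  rw [hd.eq_bot, finrank_bot, add_zero] at h5
  rw [← finrank_restrictSupport (K := K), ← finrank_restrictSupport (K := K)]
  refine Iff.trans ?_ (Iff.of_eq (congrArg (fun x => _ = x) h5))
  constructor
  · intro h
    rw [le_antisymm (sup_le (lfSpace_le I i) hle) h]
  · intro h
    exact (Submodule.eq_of_le_of_finrank_eq (sup_le (lfSpace_le I i) hle) h.symm).ge

theorem indicatorPoint_mem (h : IsDegreeBasis σ I d V) (hσ : IsDegreeOrder σ)
    {O : Finset (Mon n)} (hO : O ∈ Lam I) : indicatorPoint O ∈ orderIdealPolytope V d := by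
  classical
  obtain ⟨hord, hgr⟩ := mem_Lam_iff.1 hO
  refine ⟨fun m₁ m₂ hm => ?_, fun i hi => ?_, fun i hi U hU hcard => ?_, fun m => ?_⟩
  · simp only [indicatorPoint]
    split_ifs with h2 h1
    · exact le_rfl
    · exact absurd (hord _ h2 _ hm) h1
    · exact zero_le_one
    · exact le_rfl
  · have h1 := (finrank_lfSpace_add i (hgr i).1).1 (hgr i).2
    rw [degree_inter_eq hi, finrank_restrictSupport, h.lfDim_eq hσ hi, sum_indicatorPoint,
      Finset.filter_filter, h1,
      ncard_setOf_mem_termsLE (fun m => m.degree = i ∧ m ∈ O)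
        (fun m hm => mem_termsLE.2 (hm.1.trans_le hi))]
    have h2 : {m : Mon n | m.degree = i ∧ m ∈ O} = {m : Mon n | m ∈ O ∧ m.degree = i} :=
      Set.ext fun _ => and_comm
    rw [h2]
    push_cast
    ring
  · rw [rank_lfMatrix, h.span_leadingForm hσ hi, sum_indicatorPoint]
    have h1 := card_filter_notMem_le hgr hU
    have h2 := Finset.card_filter_add_card_filter_not (s := U) (fun m => m.1 ∈ O)
    rw [sub_le_iff_le_add]
    exact_mod_cast (by omega : U.card ≤ _)
  · simp only [indicatorPoint]
    split_ifs <;> simp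

/-- The equation in degree `i` says that the terms outside `O` are as many as the dimension of the
leading forms, so they are an admissible `U` in the rank inequality. Its left side is then `0`,
which makes the restriction of leading forms to `U` injective. -/
theorem mem_Lam_of_indicatorPoint_mem (h : IsDegreeBasis σ I d V) (hσ : IsDegreeOrder σ)
    {O : Finset (Mon n)} (hOd : O ⊆ termsLE n d)
    (hz : indicatorPoint O ∈ orderIdealPolytope V d) : O ∈ Lam I := by
  classical
  obtain ⟨hmono, hsum, hrank, -⟩ := hz
  refine mem_Lam_iff.2 ⟨fun t ht s hst => ?_, fun i => ?_⟩
  · have htd := hOd ht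
    have hsd : s ∈ termsLE n d :=
      mem_termsLE.2 ((Finsupp.degree_mono hst).trans (mem_termsLE.1 htd))
    have := hmono ⟨s, hsd⟩ ⟨t, htd⟩ hst
    by_contra hs
    simp only [indicatorPoint, if_pos ht, if_neg hs] at this
    linarith
  · by_cases hi : i ≤ d
    · have h1 := hsum i hi
      have h2 : {m : Mon n | m.degree = i ∧ m ∈ O} = {m : Mon n | m ∈ O ∧ m.degree = i} :=
        Set.ext fun _ => and_comm
      rw [degree_inter_eq hi, finrank_restrictSupport, h.lfDim_eq hσ hi, sum_indicatorPoint,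
        Finset.filter_filter, ncard_setOf_mem_termsLE (fun m => m.degree = i ∧ m ∈ O)
          (fun m hm => mem_termsLE.2 (hm.1.trans_le hi)), h2, eq_sub_iff_add_eq] at h1
      norm_cast at h1
      set U := (Finset.univ.filter fun m : ↥(termsLE n d) => m.1.degree = i).filter
        fun m => m.1 ∉ O with hU
      have hUmem : ∀ m ∈ U, m.1.degree = i ∧ m.1 ∉ O := by simp [hU]
      have hUcard : U.card = Module.finrank K (lfSpace I i) := by
        have h3 := Finset.card_filter_add_card_filter_not
          (s := Finset.univ.filter fun m : ↥(termsLE n d) => m.1.degree = i) (fun m => m.1 ∈ O)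
        rw [← hU, Finset.filter_filter, ncard_setOf_mem_termsLE
          (fun m => m.degree = i ∧ m ∈ O) (fun m hm => mem_termsLE.2 (hm.1.trans_le hi)),
          ncard_setOf_mem_termsLE (fun m => m.degree = i)
          (fun m hm => mem_termsLE.2 (hm.trans_le hi)), h2] at h3
        omega
      have h4 := hrank i hi U (fun m hm => (hUmem m hm).1)
        (hUcard.trans (h.lfDim_eq hσ hi).symm)
      have h5 : U.filter (fun m => m.1 ∈ O) = ∅ := by
        rw [Finset.filter_eq_empty_iff]
        exact fun m hm => (hUmem m hm).2
      rw [sum_indicatorPoint, h5, rank_lfMatrix, h.span_leadingForm hσ hi, hUcard,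
        Finset.card_empty, Nat.cast_zero, sub_nonpos] at h4
      norm_cast at h4
      have hfin := finite_lfSpace I i
      have h6 : LinearMap.ker ((coeffOn (K := K) U).domRestrict (lfSpace I i)) = ⊥ := by
        have h7 := LinearMap.finrank_range_add_finrank_ker
          ((coeffOn (K := K) U).domRestrict (lfSpace I i))
        rw [LinearMap.range_domRestrict] at h7
        exact Submodule.finrank_eq_zero.1 (by omega)
      have hdisj : Disjoint (lfSpace I i)
          (restrictSupport K {m : Mon n | m ∈ O ∧ m.degree = i}) := by
        rw [Submodule.disjoint_def]
        intro w hw hwO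
        have h8 : (⟨w, hw⟩ : lfSpace I i) ∈
            LinearMap.ker ((coeffOn (K := K) U).domRestrict (lfSpace I i)) := by
          rw [LinearMap.mem_ker]
          funext u
          by_contra h0
          exact (hUmem _ u.2).2 (mem_restrictSupport.1 hwO u.1.1 h0).1
        rw [h6, Submodule.mem_bot] at h8
        exact congrArg Subtype.val h8
      exact ⟨hdisj, (finrank_lfSpace_add i hdisj).2 (by omega)⟩
    · have hempty : {m : Mon n | m ∈ O ∧ m.degree = i} = ∅ := by
        ext m
        simp only [Set.mem_ofPred_eq, Set.mem_empty_iff_false, iff_false]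
        rintro ⟨hm, rfl⟩
        exact hi (mem_termsLE.1 (hOd hm))
      rw [hempty, restrictSupport_eq_span, Set.image_empty, Submodule.span_empty]
      exact ⟨disjoint_bot_right, (h.le_lfSpace hσ (by omega)).trans le_sup_left⟩

/-- The order ideals given by the integral points of the polytope are the elements of `Λ(I)`. -/
theorem mem_Lam_iff_exists (h : IsDegreeBasis σ I d V) (hσ : IsDegreeOrder σ)
    {O : Finset (Mon n)} : O ∈ Lam I ↔
      ∃ z : ↥(termsLE n d) → ℝ, z ∈ orderIdealPolytope V d ∧ IsIntegralPoint z ∧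
        orderIdealOf z = O := by
  constructor
  · intro hO
    refine ⟨indicatorPoint O, h.indicatorPoint_mem hσ hO, isIntegralPoint_indicatorPoint O,
      orderIdealOf_indicatorPoint fun m hm => mem_termsLE.2 ?_⟩
    exact (h.degree_lt hσ (mem_Lam_iff.1 hO).2 hm).le
  · rintro ⟨z, hz, hint, rfl⟩
    refine h.mem_Lam_of_indicatorPoint_mem hσ (orderIdealOf_subset z) ?_
    rwa [indicatorPoint_orderIdealOf hz hint]

end IsDegreeBasis

/-! ### Elementary steps on echelon lists -/

theorem sup_span_insert_sub {A : Submodule K (Poly K n)} {v : Poly K n} (hv : v ∈ A) (c : K)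
    (f : Poly K n) (H : Set (Poly K n)) :
    A ⊔ Submodule.span K (insert (f - C c * v) H) = A ⊔ Submodule.span K (insert f H) := by
  have hcv : C c * v ∈ A := by
    rw [C_mul']
    exact A.smul_mem _ hv
  apply le_antisymm
  · refine sup_le le_sup_left (Submodule.span_le.2 ?_)
    rintro x (rfl | hx)
    · exact Submodule.sub_mem _ (Submodule.mem_sup_right (Submodule.subset_span (by simp)))
        (Submodule.mem_sup_left hcv)
    · exact Submodule.mem_sup_right (Submodule.subset_span (Set.mem_insert_of_mem _ hx))
  · refine sup_le le_sup_left (Submodule.span_le.2 ?_)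
    rintro x (rfl | hx)
    · rw [SetLike.mem_coe, ← sub_add_cancel x (C c * v)]
      exact Submodule.add_mem _ (Submodule.mem_sup_right (Submodule.subset_span (by simp)))
        (Submodule.mem_sup_left hcv)
    · exact Submodule.mem_sup_right (Submodule.subset_span (Set.mem_insert_of_mem _ hx))

theorem span_singleton_C_mul {c : K} (hc : c ≠ 0) (f : Poly K n) :
    Submodule.span K {C c * f} = Submodule.span K {f} := by
  rw [C_mul']
  exact Submodule.span_singleton_smul_eq (isUnit_iff_ne_zero.2 hc) f

theorem listSpan_append_singleton_sup {V W : List (Poly K n)} {c : K} (hc : c ≠ 0) (f : Poly K n)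
    (H : Set (Poly K n)) :
    listSpan (V ++ (W ++ [C c * f])) ⊔ Submodule.span K H =
      listSpan (V ++ W) ⊔ Submodule.span K (insert f H) := by
  rw [← List.append_assoc, listSpan_append (V ++ W), Submodule.span_insert, ← sup_assoc,
    ← span_singleton_C_mul hc f]
  simp only [listSpan, List.mem_singleton, Set.ofPred_eq_eq_singleton]

namespace IsLeadFun

variable {R : Mon n → Mon n → Prop} {D : Submodule K (Poly K n)} {lead : Poly K n → Mon n}

theorem lead_C_mul (h : IsLeadFun R D lead) {f : Poly K n} (hf : f ∈ D) (hf0 : f ≠ 0) {c : K}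
    (hc : c ≠ 0) : lead (C c * f) = lead f := by
  refine h.lead_eq ?_ ?_ fun m hm hne => h.rel f hf m ?_ hne
  · rw [C_mul']
    exact D.smul_mem _ hf
  · rw [coeff_C_mul]
    exact mul_ne_zero hc (h.coeff_ne f hf hf0)
  · rw [coeff_C_mul] at hm
    exact right_ne_zero_of_mul hm

theorem isEchelon_append (h : IsLeadFun R D lead) {V : List (Poly K n)} (hV : IsEchelon D lead V)
    {f : Poly K n} (hf : f ∈ D) (hf0 : f ≠ 0) (hlead : ∀ v ∈ V, lead f ≠ lead v) :
    IsEchelon D lead (V ++ [C (coeff (lead f) f)⁻¹ * f]) := by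
  have hc := h.coeff_ne f hf hf0
  have hl := h.lead_C_mul hf hf0 (inv_ne_zero hc)
  refine ⟨?_, ?_, ?_⟩
  · intro v hv
    rcases List.mem_append.1 hv with hv | hv
    · exact hV.mem v hv
    · rw [List.mem_singleton.1 hv, C_mul']
      exact D.smul_mem _ hf
  · intro v hv
    rcases List.mem_append.1 hv with hv | hv
    · exact hV.monic v hv
    · rw [List.mem_singleton.1 hv, hl, coeff_C_mul, inv_mul_cancel₀ hc]
  · rw [List.map_append, List.nodup_append]
    refine ⟨hV.nodup, by simp, ?_⟩
    intro a ha b hb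
    obtain ⟨v, hv, rfl⟩ := List.mem_map.1 ha
    simp only [List.map_cons, List.map_nil, List.mem_singleton] at hb
    rw [hb, hl]
    exact (hlead v hv).symm

theorem coeff_lead_eq_zero (h : IsLeadFun R D lead) {g v : Poly K n} (hg : g ∈ D) (hv : v ∈ D)
    (hne : lead v ≠ lead g) (hc : coeff (lead v) g ≠ 0) : coeff (lead g) v = 0 := by
  by_contra h0
  exact h.wf.asymmetric _ _ (h.rel g hg _ hc hne) (h.rel v hv _ h0 hne.symm)

/-- The leading term of `v` occurs in `g` and is not that of `g`, so it lies below; subtracting a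
multiple of `v` changes `g` only below its leading term. -/
theorem lead_sub_mul (h : IsLeadFun R D lead) {g v : Poly K n} (hg : g ∈ D) (hv : v ∈ D)
    (hg1 : coeff (lead g) g = 1) (hne : lead v ≠ lead g) (hc : coeff (lead v) g ≠ 0) (c : K) :
    lead (g - C c * v) = lead g := by
  refine h.lead_eq ?_ ?_ fun m hm hml => ?_
  · rw [C_mul']
    exact D.sub_mem hg (D.smul_mem _ hv)
  · rw [coeff_sub, coeff_C_mul, h.coeff_lead_eq_zero hg hv hne hc, hg1]
    simp
  · by_cases hmg : coeff m g = 0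
    · have hmv : coeff m v ≠ 0 := by
        intro h0
        rw [coeff_sub, coeff_C_mul, hmg, h0] at hm
        simp at hm
      have h1 := h.rel g hg _ hc hne
      by_cases hmv' : m = lead v
      · exact hmv' ▸ h1
      · exact h.trans _ _ _ (h.rel v hv m hmv hmv') h1
    · exact h.rel g hg m hmg hml

theorem isEchelon_subst (h : IsLeadFun R D lead) {A B : List (Poly K n)} {g v : Poly K n}
    (hV : IsEchelon D lead (A ++ g :: B)) (hv : v ∈ A ++ B) (hc : coeff (lead v) g ≠ 0) (c : K) :
    lead v ≠ lead g ∧ IsEchelon D lead (A ++ (g - C c * v) :: B) := by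
  have hsub : ∀ x ∈ A ++ B, x ∈ A ++ g :: B := by
    intro x hx
    rw [List.mem_append] at hx
    simp only [List.mem_append, List.mem_cons]
    tauto
  have hgmem : g ∈ A ++ g :: B := by simp
  have hnd := hV.nodup
  rw [List.map_append, List.map_cons, List.nodup_middle, List.nodup_cons, ← List.map_append] at hnd
  have hne : lead v ≠ lead g := fun he => hnd.1 (List.mem_map.2 ⟨v, hv, he⟩)
  have hgD := hV.mem g hgmem
  have hvD := hV.mem v (hsub v hv)
  have hl := h.lead_sub_mul hgD hvD (hV.monic g hgmem) hne hc c
  refine ⟨hne, ?_, ?_, ?_⟩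
  · intro x hx
    rw [List.mem_append, List.mem_cons, or_left_comm, ← List.mem_append] at hx
    rcases hx with rfl | hx
    · rw [C_mul']
      exact D.sub_mem hgD (D.smul_mem _ hvD)
    · exact hV.mem x (hsub x hx)
  · intro x hx
    rw [List.mem_append, List.mem_cons, or_left_comm, ← List.mem_append] at hx
    rcases hx with rfl | hx
    · rw [hl, coeff_sub, coeff_C_mul, h.coeff_lead_eq_zero hgD hvD hne hc, hV.monic g hgmem]
      simp
    · exact hV.monic x (hsub x hx)
  · have := hV.nodup
    rwa [List.map_append, List.map_cons, ← hl, ← List.map_cons, ← List.map_append] at this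

end IsLeadFun

theorem listSpan_middle (A B : List (Poly K n)) (g : Poly K n) :
    listSpan (A ++ g :: B) = listSpan (A ++ B) ⊔ Submodule.span K (insert g ∅) := by
  rw [listSpan, listSpan, ← Submodule.span_union]
  congr 1
  ext x
  simp only [Set.mem_ofPred_eq, Set.mem_union, List.mem_append, List.mem_cons, Set.mem_insert_iff,
    Set.mem_empty_iff_false]
  tauto

theorem listSpan_subst {A B : List (Poly K n)} {g v : Poly K n} (hv : v ∈ A ++ B) (c : K) :
    listSpan (A ++ (g - C c * v) :: B) = listSpan (A ++ g :: B) := by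
  rw [listSpan_middle, listSpan_middle, sup_span_insert_sub (mem_listSpan hv)]

/-! ### Invariants of the algorithm -/

/-- The space of polynomials to which the leading term function of an elimination applies. -/
def Call.dom (K : Type*) [Field K] {n : ℕ} : Call n → Submodule K (Poly K n)
  | .spanInit _ => ⊤
  | .spanExtend _ => ⊤
  | .basisTrans _ cols => restrictSupport K {m | m ∈ cols}

/-- The relation on terms that belongs to the leading term function of an elimination. -/
def Call.rel {n : ℕ} (σ : MonomialOrder (Fin n)) : Call n → Mon n → Mon n → Prop
  | .spanInit _ => fun a b => σ.toSyn a < σ.toSyn b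
  | .spanExtend _ => fun a b => σ.toSyn a < σ.toSyn b
  | .basisTrans _ cols => fun a b => cols.length - cols.idxOf a < cols.length - cols.idxOf b

theorem Call.isLeadFun (σ : MonomialOrder (Fin n)) (c : Call n) :
    IsLeadFun (c.rel σ) (c.dom K) (c.lead σ) :=
  match c with
  | .spanInit _ => isLeadFun_degree σ
  | .spanExtend _ => isLeadFun_degree σ
  | .basisTrans _ cols => isLeadFun_head cols

/-- `V` is an intermediate result of the computation of the `T_{≤ d}`-stable span of `F`. -/
structure IsPartialSpan (σ : MonomialOrder (Fin n)) (F : Finset (Poly K n)) (d : ℕ)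
    (V : List (Poly K n)) : Prop where
  echelon : IsEchelon ⊤ σ.degree V
  le : listSpan V ≤ polyLE K n d
  mem_ideal : ∀ v ∈ V, v ∈ Ideal.span (F : Set (Poly K n))
  mem_span : ∀ f ∈ F, f ∈ listSpan V

/-- `O` belongs to `Λ(I)`, the columns are ordered accordingly, and `E` is the space of the elements
of `I` whose terms are columns. -/
structure IsTransInput (I : Ideal (Poly K n)) (O : Finset (Mon n)) (cols : List (Mon n)) (d : ℕ)
    (E : Submodule K (Poly K n)) : Prop where
  mem_Lam : O ∈ Lam I
  mem_cols : ∀ m, m ∈ cols ↔ m.degree ≤ d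
  pairwise : cols.Pairwise fun a b => a ∈ O → b ∈ O
  mem_iff : ∀ p, p ∈ E ↔ p ∈ I ∧ p ∈ polyLE K n d
  degree_lt : ∀ m ∈ O, m.degree < d

open Classical in
/-- In the elimination `c` with initial list `V`, the space `E` is to be spanned. -/
def CallInv (σ : MonomialOrder (Fin n)) (F : Finset (Poly K n)) (V : List (Poly K n))
    (E : Submodule K (Poly K n)) : Call n → Prop
  | .spanInit d => V = [] ∧ maxDegree F ≤ d ∧ E = Submodule.span K F
  | .spanExtend d => IsPartialSpan σ F d V ∧ E = Submodule.span K (neighborhood V.toFinset)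
  | .basisTrans O cols => V = [] ∧ ∃ d, IsTransInput (Ideal.span (F : Set (Poly K n))) O cols d E

/-- The invariant of the algorithm. -/
def Inv (σ : MonomialOrder (Fin n)) (F : Finset (Poly K n)) : State K n → Prop
  | .span d => maxDegree F ≤ d
  | .gauss c V W H => ∃ E, CallInv σ F V E c ∧ IsEchelon (c.dom K) (c.lead σ) (V ++ W) ∧
      (∀ f ∈ H, f ∈ c.dom K) ∧ listSpan (V ++ W) ⊔ Submodule.span K (H : Set (Poly K n)) = E
  | .reduce c V W H f i => ∃ E, CallInv σ F V E c ∧ IsEchelon (c.dom K) (c.lead σ) (V ++ W) ∧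
      (∀ f ∈ H, f ∈ c.dom K) ∧ f ∈ c.dom K ∧
      listSpan (V ++ W) ⊔ Submodule.span K (insert f (H : Set (Poly K n))) = E ∧
      ∀ k < i, ∀ v, (V ++ W)[k]? = some v → c.lead σ f ≠ c.lead σ v
  | .returned c V W => ∃ E, CallInv σ F V E c ∧ IsEchelon (c.dom K) (c.lead σ) (V ++ W) ∧
      listSpan (V ++ W) = E
  | .extend d V => IsPartialSpan σ F d V
  | .test d V => IsPartialSpan σ F d V ∧ IsStable d (listSpan V)
  | .choose d V => IsDegreeBasis σ (Ideal.span (F : Set (Poly K n))) d V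
  | .transform V O => O ∈ Lam (Ideal.span (F : Set (Poly K n))) ∧
      ∃ d, IsDegreeBasis σ (Ideal.span (F : Set (Poly K n))) d V
  | .backSubst O cols G => ∃ d, IsTransInput (Ideal.span (F : Set (Poly K n))) O cols d
      (listSpan G) ∧ IsEchelon (restrictSupport K {m | m ∈ cols}) (head cols) G
  | .done O G => O ∈ Lam (Ideal.span (F : Set (Poly K n))) ∧
      IsBorderBasis O (Ideal.span (F : Set (Poly K n))) G

theorem coe_toFinset_eq (V : List (Poly K n)) [DecidableEq (Poly K n)] :
    (V.toFinset : Set (Poly K n)) = {v | v ∈ V} := by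
  ext
  simp

theorem mem_polyLE_iff {d : ℕ} {p : Poly K n} : p ∈ polyLE K n d ↔ p.totalDegree ≤ d := by
  rw [mem_restrictSupport]
  exact ⟨fun h => Finset.sup_le fun m hm => h m (mem_support_iff.1 hm),
    fun h m hm => (le_totalDegree (mem_support_iff.2 hm)).trans h⟩

theorem nbhd_listSpan_le (V : List (Poly K n)) [DecidableEq (Poly K n)] :
    nbhd (listSpan V) ≤ Submodule.span K (neighborhood V.toFinset : Set (Poly K n)) := by
  refine sup_le (Submodule.span_mono fun v hv => ?_) (iSup_le fun j => ?_)
  · simp only [neighborhood, Finset.coe_union, Set.mem_union, Finset.mem_coe, List.mem_toFinset]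
    exact Or.inl hv
  · rw [Submodule.map_span, Submodule.span_le]
    rintro _ ⟨v, hv, rfl⟩
    refine Submodule.subset_span ?_
    simp only [neighborhood, Finset.coe_union, Set.mem_union, Finset.mem_coe, Finset.mem_biUnion,
      Finset.mem_image]
    exact Or.inr ⟨j, Finset.mem_univ _, v, List.mem_toFinset.2 hv, rfl⟩

theorem neighborhood_subset_ideal {I : Ideal (Poly K n)} {V : List (Poly K n)}
    [DecidableEq (Poly K n)] (hV : ∀ v ∈ V, v ∈ I) :
    Submodule.span K (neighborhood V.toFinset : Set (Poly K n)) ≤ I.restrictScalars K := by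
  rw [Submodule.span_le]
  intro p hp
  simp only [neighborhood, Finset.coe_union, Set.mem_union, Finset.mem_coe, Finset.mem_biUnion,
    Finset.mem_image, List.mem_toFinset] at hp
  rcases hp with hp | ⟨j, -, v, hv, rfl⟩
  · exact hV p hp
  · exact I.mul_mem_right _ (hV v hv)

theorem listSpan_le_polyLE_iff {d : ℕ} {V : List (Poly K n)} :
    listSpan V ≤ polyLE K n d ↔ ∀ v ∈ V, v.totalDegree ≤ d := by
  rw [Submodule.span_le]
  exact forall₂_congr fun v _ => mem_polyLE_iff

namespace IsPartialSpan

variable {σ : MonomialOrder (Fin n)} {F : Finset (Poly K n)} {d : ℕ} {V : List (Poly K n)}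

theorem of_init (hd : maxDegree F ≤ d) (hV : IsEchelon ⊤ σ.degree V)
    (hspan : listSpan V = Submodule.span K F) : IsPartialSpan σ F d V where
  echelon := hV
  le := by
    rw [hspan, Submodule.span_le]
    exact fun f hf => mem_polyLE_iff.2 ((Finset.le_sup (f := totalDegree) hf).trans hd)
  mem_ideal v hv := by
    have h : v ∈ Submodule.span K (F : Set (Poly K n)) := hspan ▸ mem_listSpan hv
    exact Submodule.span_le_restrictScalars K (Poly K n) (F : Set (Poly K n)) h
  mem_span f hf := by
    rw [hspan]
    exact Submodule.subset_span hf

theorem maxDegree_le (h : IsPartialSpan σ F d V) : maxDegree F ≤ d :=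
  Finset.sup_le fun f hf => mem_polyLE_iff.1 (h.le (h.mem_span f hf))

theorem extend [DecidableEq (Poly K n)] (h : IsPartialSpan σ F d V) {W : List (Poly K n)}
    (hW : IsEchelon ⊤ σ.degree (V ++ W))
    (hspan : listSpan (V ++ W) = Submodule.span K (neighborhood V.toFinset : Set (Poly K n))) :
    IsPartialSpan σ F d (V ++ W.filter fun w => decide (w.totalDegree ≤ d)) where
  echelon := hW.sublist (List.Sublist.append_left List.filter_sublist V)
  le := by
    rw [listSpan_le_polyLE_iff]
    intro v hv
    rcases List.mem_append.1 hv with hv | hv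
    · exact listSpan_le_polyLE_iff.1 h.le v hv
    · simpa using (List.mem_filter.1 hv).2
  mem_ideal v hv := by
    have hv' : v ∈ listSpan (V ++ W) :=
      mem_listSpan ((List.Sublist.append_left List.filter_sublist V).subset hv)
    rw [hspan] at hv'
    exact neighborhood_subset_ideal h.mem_ideal hv'
  mem_span f hf := by
    rw [listSpan_append]
    exact Submodule.mem_sup_left (h.mem_span f hf)

/-- Elements of the neighbourhood of degree at most `d` are combinations of rows of degree at most
`d`, and all such rows are already in `V`. -/
theorem isStable [DecidableEq (Poly K n)] (hσ : IsDegreeOrder σ) (h : IsPartialSpan σ F d V)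
    {W : List (Poly K n)} (hW : IsEchelon ⊤ σ.degree (V ++ W))
    (hspan : listSpan (V ++ W) = Submodule.span K (neighborhood V.toFinset : Set (Poly K n)))
    (hnil : (W.filter fun w => decide (w.totalDegree ≤ d)) = []) :
    IsStable d (listSpan V) where
  le := h.le
  stable := by
    rintro p ⟨hp, hpd⟩
    have hp' : p ∈ listSpan (V ++ W) := hspan ▸ nbhd_listSpan_le V hp
    refine Submodule.span_mono ?_ (hW.mem_span_degree_le hσ hp' hpd)
    rintro w ⟨hw, hwd⟩
    refine (List.mem_append.1 hw).resolve_right fun hw' => ?_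
    have : w ∈ W.filter fun w => decide (w.totalDegree ≤ d) :=
      List.mem_filter.2 ⟨hw', by simpa using hwd⟩
    rw [hnil] at this
    simp at this

theorem isDegreeBasis (h : IsPartialSpan σ F d V) (hst : IsStable d (listSpan V))
    (htop : ∀ t : Mon n, t.degree = d → ∃ v ∈ V, σ.degree v = t) :
    IsDegreeBasis σ (Ideal.span (F : Set (Poly K n))) d V where
  echelon := h.echelon
  mem_iff p := by
    have hle : listSpan V ≤ (Ideal.span (F : Set (Poly K n))).restrictScalars K :=
      Submodule.span_le.2 h.mem_ideal
    refine ⟨fun hp => ⟨hle hp, h.le hp⟩, fun hp => ?_⟩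
    refine hst.mem_of_mem_span (polyLE_le_sup σ h.le fun t ht => ?_) h.mem_span hp.1 hp.2
    obtain ⟨v, hv, hvt⟩ := htop t ht
    exact ⟨v, mem_listSpan hv, h.echelon.ne_zero hv, hvt⟩
  top := htop

end IsPartialSpan

/-- The basis transformation uses the columns of degree at most `ℓ`, the maximal degree in `V`;
these are the terms of degree at most `d`. If there is an indeterminate, `x_j^d` is a leading term
and `ℓ = d`. -/
theorem IsDegreeBasis.degree_le_iff [DecidableEq (Poly K n)] {σ : MonomialOrder (Fin n)}
    (hσ : IsDegreeOrder σ)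
    {I : Ideal (Poly K n)} {d : ℕ} {V : List (Poly K n)} (h : IsDegreeBasis σ I d V) (m : Mon n) :
    m.degree ≤ maxDegree V.toFinset ↔ m.degree ≤ d := by
  have hle : maxDegree V.toFinset ≤ d := Finset.sup_le fun v hv =>
    mem_polyLE_iff.1 ((h.mem_iff v).1 (mem_listSpan (List.mem_toFinset.1 hv))).2
  refine ⟨fun hm => hm.trans hle, fun hm => ?_⟩
  -- Without indeterminates `ℓ` may be smaller than `d`, but `1` is the only term.
  rcases isEmpty_or_nonempty (Fin n) with hn | ⟨⟨j⟩⟩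
  · have : m = 0 := Subsingleton.elim _ _
    simp [this]
  · obtain ⟨v, hv, hvd⟩ := h.top (Finsupp.single j d) (Finsupp.degree_single j d)
    have h1 : v.totalDegree ≤ maxDegree V.toFinset :=
      Finset.le_sup (f := totalDegree) (List.mem_toFinset.2 hv)
    rw [hσ.totalDegree_eq, hvd, Finsupp.degree_single] at h1
    exact hm.trans h1

theorem IsDegreeBasis.isTransInput [DecidableEq (Poly K n)] {σ : MonomialOrder (Fin n)}
    (hσ : IsDegreeOrder σ)
    {I : Ideal (Poly K n)} {d : ℕ} {V : List (Poly K n)} (h : IsDegreeBasis σ I d V)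
    {O : Finset (Mon n)} (hO : O ∈ Lam I) {cols : List (Mon n)}
    (hcols : IsColumnOrder (maxDegree V.toFinset) O cols) :
    IsTransInput I O cols d (listSpan V) where
  mem_Lam := hO
  mem_cols m := (hcols.2.1 m).trans (h.degree_le_iff hσ m)
  pairwise := hcols.2.2
  mem_iff := h.mem_iff
  degree_lt _ hm := h.degree_lt hσ (mem_Lam_iff.1 hO).2 hm

/-! ### The output of the algorithm -/

namespace IsTransInput

variable {I : Ideal (Poly K n)} {O : Finset (Mon n)} {cols : List (Mon n)} {d : ℕ}
  {G : List (Poly K n)}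

theorem idxOf_lt {E : Submodule K (Poly K n)} (h : IsTransInput I O cols d E) {a b : Mon n}
    (ha : a ∉ O) (had : a.degree ≤ d) (hb : b ∈ O) :
    cols.length - cols.idxOf b < cols.length - cols.idxOf a := by
  have hac := (h.mem_cols a).2 had
  have hbc := (h.mem_cols b).2 (h.degree_lt b hb).le
  have h1 := List.idxOf_lt_length_iff.2 hac
  have h2 := List.idxOf_lt_length_iff.2 hbc
  have hne : cols.idxOf a ≠ cols.idxOf b := fun he => ha ((List.idxOf_inj hac).1 he ▸ hb)
  by_contra hlt
  have h3 : cols.idxOf b < cols.idxOf a := by omega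
  have h4 := List.pairwise_iff_getElem.1 h.pairwise _ _ h2 h1 h3
  rw [List.getElem_idxOf, List.getElem_idxOf] at h4
  exact ha (h4 hb)

/-- The difference of `b` and its normal form has degree at most `d`, hence lies in the row space,
and its head is `b` because the columns of `O` are further to the right. -/
theorem exists_head_eq (h : IsTransInput I O cols d (listSpan G))
    (hG : IsEchelon (restrictSupport K {m | m ∈ cols}) (head cols) G) {b : Mon n} (hb : b ∉ O)
    (hbd : b.degree ≤ d) {a : Mon n → K} (ha : monomial b 1 - ∑ t ∈ O, monomial t (a t) ∈ I) :
    ∃ g ∈ G, head cols g = b := by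
  set u : Poly K n := monomial b 1 - ∑ t ∈ O, monomial t (a t) with hu
  have hOcoeff : ∀ m, m ∉ O → coeff m (∑ t ∈ O, monomial t (a t)) = 0 := by
    intro m hm
    by_contra h0
    exact hm (mem_restrictSupport.1 (sum_monomial_mem O a) m h0)
  have hub : coeff b u = 1 := by
    rw [hu, coeff_sub, hOcoeff b hb, coeff_monomial, if_pos rfl, sub_zero]
  have huO : ∀ m, coeff m u ≠ 0 → m ≠ b → m ∈ O := by
    intro m hm hmb
    by_contra hmO
    rw [hu, coeff_sub, hOcoeff m hmO, coeff_monomial, if_neg (Ne.symm hmb), sub_zero] at hm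
    exact hm rfl
  have hud : u ∈ polyLE K n d := by
    rw [mem_restrictSupport]
    intro m hm
    by_cases hmb : m = b
    · rw [hmb]
      exact hbd
    · exact (h.degree_lt m (huO m hm hmb)).le
  have hucols : u ∈ restrictSupport K {m | m ∈ cols} :=
    mem_restrictSupport.2 fun m hm => (h.mem_cols m).2 (mem_restrictSupport.1 hud m hm)
  have hu0 : u ≠ 0 := by
    intro h0
    rw [h0] at hub
    simp at hub
  have hhead : head cols u = b :=
    (isLeadFun_head cols).lead_eq hucols (by rw [hub]; exact one_ne_zero)
      fun m hm hmb => h.idxOf_lt hb hbd (huO m hm hmb)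
  obtain ⟨g, hg, hgu, -⟩ := (isLeadFun_head cols).exists_lead_eq hG
    ((h.mem_iff u).2 ⟨ha, hud⟩) hu0
  exact ⟨g, hg, hgu.trans hhead⟩

theorem degree_le_of_mem_border {E : Submodule K (Poly K n)} (h : IsTransInput I O cols d E)
    {b : Mon n} (hb : b ∈ border O) : b.degree ≤ d := by
  by_cases hO : O = ∅
  · have : b = 0 := by simpa [border, hO] using hb
    simp [this]
  · obtain ⟨⟨j, t, ht, rfl⟩, -⟩ := (mem_border hO).1 hb
    rw [degree_add_single]
    exact h.degree_lt t ht

/-- Every column outside `O` is the head of some row, so a reduced row has only its head outside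
`O`. It then differs from the head minus its normal form by an element of `I ∩ ⟨O⟩ = 0`. -/
theorem isBorderBasis [DecidableEq (Poly K n)] (h : IsTransInput I O cols d (listSpan G))
    (hG : IsEchelon (restrictSupport K {m | m ∈ cols}) (head cols) G)
    (hred : ∀ g ∈ G, ∀ v ∈ G, v ≠ g → coeff (head cols v) g = 0) :
    IsBorderBasis O I (G.toFinset.filter fun g => head cols g ∈ border O) := by
  classical
  obtain ⟨hord, hgr⟩ := mem_Lam_iff.1 h.mem_Lam
  have hc := hgr.isCompl
  choose α hα using fun b : Mon n => exists_normalForm hc (monomial b 1)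
  have hspec : ∀ g ∈ G, head cols g ∈ border O →
      monomial (head cols g) 1 - ∑ t ∈ O, monomial t (α (head cols g) t) = g := by
    intro g hg hb
    have hgI := ((h.mem_iff g).1 (mem_listSpan hg)).1
    have hmem := I.sub_mem (hα (head cols g)) hgI
    rw [← sub_eq_zero]
    refine Submodule.disjoint_def.1 hc.disjoint _ hmem (mem_restrictSupport.2 fun m hm => ?_)
    by_contra hmO
    rw [Finset.mem_coe] at hmO
    have hmO' : coeff m (∑ t ∈ O, monomial t (α (head cols g) t)) = 0 := by
      by_contra h0
      exact hmO (mem_restrictSupport.1 (sum_monomial_mem O _) m h0)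
    rw [coeff_sub, coeff_sub, hmO', coeff_monomial, sub_zero] at hm
    by_cases hmg : head cols g = m
    · rw [if_pos hmg, ← hmg, hG.monic g hg, sub_self] at hm
      exact hm rfl
    · rw [if_neg hmg, zero_sub, neg_ne_zero] at hm
      have hmd : m.degree ≤ d :=
        (h.mem_cols m).1 (mem_restrictSupport.1 (hG.mem g hg) m hm)
      obtain ⟨v, hv, rfl⟩ := h.exists_head_eq hG hmO hmd (hα m)
      exact hm (hred g hg v hv fun he => hmg (he ▸ rfl))
  convert isBorderBasis_of_mem hord hc α fun b _ => hα b using 1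
  ext g
  simp only [Finset.mem_filter, List.mem_toFinset, Finset.mem_image]
  constructor
  · rintro ⟨hg, hb⟩
    exact ⟨_, hb, hspec g hg hb⟩
  · rintro ⟨b, hb, rfl⟩
    obtain ⟨g, hg, rfl⟩ := h.exists_head_eq hG (notMem_of_mem_border hb)
      (h.degree_le_of_mem_border hb) (hα b)
    rw [hspec g hg hb]
    exact ⟨hg, hb⟩

end IsTransInput

/-! ### Preservation of the invariant -/

theorem Inv.gauss_step {σ : MonomialOrder (Fin n)} {F : Finset (Poly K n)} {c : Call n}
    {V W : List (Poly K n)} {H : Finset (Poly K n)} (h : Inv σ F (.gauss c V W H))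
    {t : State K n} (hs : Step σ F (.gauss c V W H) t) : Inv σ F t := by
  classical
  obtain ⟨E, hc, hech, hH, hspan⟩ := h
  cases hs with
  | pick _ _ _ _ f hf =>
    refine ⟨E, hc, hech, fun g hg => hH g (Finset.mem_of_mem_erase hg), hH f hf, ?_, by simp⟩
    rw [← hspan, ← Finset.coe_insert, Finset.insert_erase hf]
  | ret =>
    refine ⟨E, hc, hech, ?_⟩
    simpa using hspan

/-- The clause on positions before `i` records failed comparisons. It is vacuous after each restart
at `0`, and when the list is exhausted it says that the leading term of `f` is new. -/
theorem Inv.reduce_step {σ : MonomialOrder (Fin n)} {F : Finset (Poly K n)} {c : Call n}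
    {V W : List (Poly K n)} {H : Finset (Poly K n)} {f : Poly K n} {i : ℕ}
    (h : Inv σ F (.reduce c V W H f i))
    {t : State K n} (hs : Step σ F (.reduce c V W H f i) t) : Inv σ F t := by
  obtain ⟨E, hc, hech, hH, hf, hspan, hlt⟩ := h
  cases hs with
  | cancel _ _ _ _ _ _ v hf0 hv hl =>
    have hmem := List.mem_of_getElem? hv
    refine ⟨E, hc, hech, hH, ?_, ?_, by simp⟩
    · rw [C_mul']
      exact Submodule.sub_mem _ hf (Submodule.smul_mem _ _ (hech.mem v hmem))
    · rw [sup_span_insert_sub (mem_listSpan hmem), hspan]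
  | next _ _ _ _ _ _ v hf0 hv hl =>
    refine ⟨E, hc, hech, hH, hf, hspan, fun k hk w hw => ?_⟩
    rcases Nat.lt_succ_iff_lt_or_eq.1 hk with hk | rfl
    · exact hlt k hk w hw
    · rw [hv, Option.some.injEq] at hw
      exact hw ▸ hl
  | drop =>
    refine ⟨E, hc, hech, hH, ?_⟩
    rw [← hspan, Submodule.span_insert_zero]
  | append _ _ _ _ _ _ hf0 hi =>
    have hlead : ∀ v ∈ V ++ W, c.lead σ f ≠ c.lead σ v := by
      intro v hv
      obtain ⟨k, hk, rfl⟩ := List.getElem_of_mem hv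
      exact hlt k (by omega) _ (List.getElem?_eq_getElem hk)
    refine ⟨E, hc, ?_, hH, ?_⟩
    · rw [← List.append_assoc]
      exact (c.isLeadFun σ).isEchelon_append hech hf hf0 hlead
    · rw [← hspan]
      exact listSpan_append_singleton_sup
        (inv_ne_zero ((c.isLeadFun σ).coeff_ne f hf hf0)) f _

theorem Inv.step {σ : MonomialOrder (Fin n)} (hσ : IsDegreeOrder σ) {F : Finset (Poly K n)}
    {s t : State K n} (h : Inv σ F s) (hs : Step σ F s t) : Inv σ F t := by
  classical
  cases s with
  | span d =>
    cases hs
    exact ⟨Submodule.span K F, ⟨rfl, h, rfl⟩, IsEchelon.nil, fun _ _ => Submodule.mem_top,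
      by simp [listSpan]⟩
  | gauss c V W H => exact h.gauss_step hs
  | reduce c V W H f i => exact h.reduce_step hs
  | returned c V W =>
    obtain ⟨E, hc, hech, hspan⟩ := h
    cases hs with
    | spanInitRet d =>
      obtain ⟨rfl, hd, rfl⟩ := hc
      exact IsPartialSpan.of_init hd hech hspan
    | spanMore d _ _ W' hW hne =>
      obtain ⟨hV, rfl⟩ := hc
      subst hW
      exact hV.extend hech hspan
    | spanStop d _ _ hW =>
      obtain ⟨hV, rfl⟩ := hc
      exact ⟨hV, hV.isStable hσ hech hspan hW⟩
    | transRet O cols =>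
      obtain ⟨rfl, d, hin⟩ := hc
      subst hspan
      exact ⟨d, hin, hech⟩
  | extend d V =>
    cases hs
    refine ⟨_, ⟨h, rfl⟩, ?_, fun _ _ => Submodule.mem_top, ?_⟩
    · rw [List.append_nil]
      exact h.echelon
    · rw [List.append_nil, ← Submodule.span_union, ← coe_toFinset_eq, ← Finset.coe_union,
        Finset.union_sdiff_of_subset]
      exact Finset.subset_union_left
  | test d V =>
    cases hs with
    | increase => exact h.1.maxDegree_le.trans (Nat.le_succ d)
    | pass _ _ htop => exact h.1.isDegreeBasis h.2 htop
  | choose d V =>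
    cases hs with
    | choosePoint _ _ z hz hint =>
      exact ⟨(IsDegreeBasis.mem_Lam_iff_exists h hσ).2 ⟨z, hz, hint, rfl⟩, d, h⟩
  | transform V O =>
    cases hs with
    | permute _ _ cols hcols =>
      obtain ⟨hO, d, hV⟩ := h
      have hin := hV.isTransInput hσ hO hcols
      refine ⟨listSpan V, ⟨rfl, d, hin⟩, IsEchelon.nil, fun f hf => ?_, ?_⟩
      · refine mem_restrictSupport.2 fun m hm => (hin.mem_cols m).2 ?_
        exact mem_restrictSupport.1
          ((hin.mem_iff f).1 (mem_listSpan (List.mem_toFinset.1 hf))).2 m hm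
      · rw [coe_toFinset_eq]
        simp [listSpan]
  | backSubst O cols G =>
    obtain ⟨d, hin, hech⟩ := h
    cases hs with
    | subst _ _ A B g v hv hc =>
      refine ⟨d, ?_, ((isLeadFun_head cols).isEchelon_subst hech hv hc _).2⟩
      rw [listSpan_subst hv]
      exact hin
    | finish _ _ _ hred =>
      refine ⟨hin.mem_Lam, hin.isBorderBasis hech fun g hg v hv hvg => ?_⟩
      obtain ⟨A, B, rfl⟩ := List.append_of_mem hg
      refine hred A B g rfl v ?_
      simp only [List.mem_append, List.mem_cons] at hv ⊢
      tauto
  | done O G => cases hs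

theorem Inv.of_reachable {σ : MonomialOrder (Fin n)} (hσ : IsDegreeOrder σ)
    {F : Finset (Poly K n)} {s : State K n} (hs : Reachable σ F s) : Inv σ F s := by
  induction hs with
  | refl => exact le_rfl (a := maxDegree F)
  | tail _ h ih => exact ih.step hσ h

/-! ### Progress -/

theorem exists_isColumnOrder (ℓ : ℕ) (O : Finset (Mon n)) : ∃ cols, IsColumnOrder ℓ O cols := by
  classical
  refine ⟨(termsLE n ℓ \ O).toList ++ (termsLE n ℓ ∩ O).toList, ?_, fun m => ?_, ?_⟩
  · rw [List.nodup_append]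
    refine ⟨Finset.nodup_toList _, Finset.nodup_toList _, ?_⟩
    intro a ha b hb hab
    rw [Finset.mem_toList, Finset.mem_sdiff] at ha
    rw [Finset.mem_toList, Finset.mem_inter] at hb
    exact ha.2 (hab ▸ hb.2)
  · rw [List.mem_append, Finset.mem_toList, Finset.mem_toList, ← mem_termsLE, Finset.mem_sdiff,
      Finset.mem_inter]
    tauto
  · rw [List.pairwise_append]
    refine ⟨List.pairwise_of_forall_mem_list ?_, List.pairwise_of_forall_mem_list ?_, ?_⟩
    · intro a ha b _ haO
      rw [Finset.mem_toList, Finset.mem_sdiff] at ha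
      exact absurd haO ha.2
    · intro a _ b hb _
      rw [Finset.mem_toList, Finset.mem_inter] at hb
      exact hb.2
    · intro a _ b hb _
      rw [Finset.mem_toList, Finset.mem_inter] at hb
      exact hb.2

/-- The critical place is the choice of an integral point: the polytope has one because `Λ(I)` is
nonempty. -/
theorem Inv.exists_step {σ : MonomialOrder (Fin n)} (hσ : IsDegreeOrder σ)
    {F : Finset (Poly K n)} (hI : Module.Finite K (Poly K n ⧸ Ideal.span (F : Set (Poly K n))))
    {s : State K n} (h : Inv σ F s) : (∃ t, Step σ F s t) ∨ ∃ O G, s = .done O G := by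
  classical
  cases s with
  | span d => exact Or.inl ⟨_, .spanStart d⟩
  | gauss c V W H =>
    rcases H.eq_empty_or_nonempty with rfl | ⟨f, hf⟩
    · exact Or.inl ⟨_, .ret c V W⟩
    · exact Or.inl ⟨_, .pick c V W H f hf⟩
  | reduce c V W H f i =>
    by_cases hf : f = 0
    · subst hf
      exact Or.inl ⟨_, .drop c V W H i⟩
    · rcases lt_or_ge i (V ++ W).length with hi | hi
      · have hv := List.getElem?_eq_getElem hi
        by_cases hl : c.lead σ f = c.lead σ (V ++ W)[i]
        · exact Or.inl ⟨_, .cancel c V W H f i _ hf hv hl⟩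
        · exact Or.inl ⟨_, .next c V W H f i _ hf hv hl⟩
      · exact Or.inl ⟨_, .append c V W H f i hf hi⟩
  | returned c V W =>
    cases c with
    | spanInit d => exact Or.inl ⟨_, .spanInitRet d V W⟩
    | spanExtend d =>
      by_cases hW : (W.filter fun w => decide (w.totalDegree ≤ d)) = []
      · exact Or.inl ⟨_, .spanStop d V W (by convert hW)⟩
      · exact Or.inl ⟨_, .spanMore d V W _ rfl (by convert hW)⟩
    | basisTrans O cols => exact Or.inl ⟨_, .transRet O cols V W⟩
  | extend d V => exact Or.inl ⟨_, .spanExtend d V⟩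
  | test d V =>
    by_cases ht : ∀ t : Mon n, t.degree = d → ∃ v ∈ V, σ.degree v = t
    · exact Or.inl ⟨_, .pass d V ht⟩
    · exact Or.inl ⟨_, .increase d V ht⟩
  | choose d V =>
    obtain ⟨O, hO⟩ := exists_mem_Lam hσ hI
    obtain ⟨z, hz, hint, -⟩ := (IsDegreeBasis.mem_Lam_iff_exists h hσ).1 hO
    exact Or.inl ⟨_, .choosePoint d V z hz hint⟩
  | transform V O =>
    obtain ⟨cols, hcols⟩ := exists_isColumnOrder (maxDegree V.toFinset) O
    exact Or.inl ⟨_, .permute V O cols (by convert hcols)⟩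
  | backSubst O cols G =>
    by_cases hred : ∀ (A B : List (Poly K n)) (g : Poly K n), G = A ++ g :: B →
        ∀ h ∈ A ++ B, coeff (head cols h) g = 0
    · exact Or.inl ⟨_, .finish O cols G hred⟩
    · push Not at hred
      obtain ⟨A, B, g, rfl, v, hv, hc⟩ := hred
      exact Or.inl ⟨_, .subst O cols A B g v hv hc⟩
  | done O G => exact Or.inr ⟨O, G, rfl⟩

/-! ### Termination -/

/-- The support of a polynomial as a binary number, the left-most column being the most significant
digit. -/
def supportWeight (cols : List (Mon n)) (p : Poly K n) : ℕ :=
  ∑ k ∈ p.support.image fun m => cols.length - cols.idxOf m, 2 ^ k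

/-- The digit at the head of `v` is cleared, and new digits can only come from `v`, to the right of
its head. -/
theorem supportWeight_sub_lt {cols : List (Mon n)} {g v : Poly K n}
    (hg : g ∈ restrictSupport K {m | m ∈ cols}) (hv : v ∈ restrictSupport K {m | m ∈ cols})
    (hv1 : coeff (head cols v) v = 1) (hc : coeff (head cols v) g ≠ 0) :
    supportWeight cols (g - C (coeff (head cols v) g) * v) < supportWeight cols g := by
  have hinj : ∀ a b : Mon n, a ∈ cols → b ∈ cols →
      cols.length - cols.idxOf a = cols.length - cols.idxOf b → a = b := by
    intro a b ha hb hab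
    have h1 := List.idxOf_lt_length_iff.2 ha
    have h2 := List.idxOf_lt_length_iff.2 hb
    exact (List.idxOf_inj ha).1 (by omega)
  have hzero : coeff (head cols v) (g - C (coeff (head cols v) g) * v) = 0 := by
    rw [coeff_sub, coeff_C_mul, hv1, mul_one, sub_self]
  have hgcols := mem_restrictSupport.1 hg
  have hvcols := mem_restrictSupport.1 hv
  rw [supportWeight, supportWeight, Finset.geomSum_lt_geomSum_iff_toColex_lt_toColex le_rfl,
    Finset.Colex.toColex_lt_toColex_iff_exists_forall_lt]
  refine ⟨_, Finset.mem_image_of_mem _ (mem_support_iff.2 hc), ?_, ?_⟩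
  · intro hmem
    obtain ⟨m, hm, he⟩ := Finset.mem_image.1 hmem
    rw [mem_support_iff] at hm
    have hmcols : m ∈ cols := by
      by_contra hmc
      rw [coeff_sub, coeff_C_mul, not_ne_iff.1 (mt (hgcols m) hmc),
        not_ne_iff.1 (mt (hvcols m) hmc)] at hm
      simp at hm
    exact hm (hinj _ _ hmcols (hgcols _ hc) he ▸ hzero)
  · intro k hk hkg
    obtain ⟨m, hm, rfl⟩ := Finset.mem_image.1 hk
    rw [mem_support_iff] at hm
    have hmg : coeff m g = 0 := by
      by_contra h0
      exact hkg (Finset.mem_image_of_mem _ (mem_support_iff.2 h0))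
    have hmv : coeff m v ≠ 0 := by
      intro h0
      rw [coeff_sub, coeff_C_mul, hmg, h0] at hm
      simp at hm
    exact (isLeadFun_head cols).rel v hv m hmv fun he => hm (he ▸ hzero)

/-- The algorithm terminates when started in the state `s`. -/
abbrev TerminatesFrom (σ : MonomialOrder (Fin n)) (F : Finset (Poly K n)) (s : State K n) : Prop :=
  Acc (fun t s => Step σ F s t) s

section

variable {σ : MonomialOrder (Fin n)} {F : Finset (Poly K n)}

theorem terminatesFrom_backSubst (hσ : IsDegreeOrder σ) {O : Finset (Mon n)} {cols : List (Mon n)}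
    {G : List (Poly K n)} (h : Inv σ F (.backSubst O cols G)) :
    TerminatesFrom σ F (.backSubst O cols G) := by
  induction hk : (G.map (supportWeight cols)).sum using Nat.strong_induction_on generalizing G with
  | _ k ih =>
    refine ⟨_, fun t ht => ?_⟩
    have hinv := h.step hσ ht
    obtain ⟨d, -, hech⟩ := h
    cases ht with
    | subst _ _ A B g v hv hc =>
      refine ih _ ?_ hinv rfl
      have hvG : v ∈ A ++ g :: B := by
        simp only [List.mem_append, List.mem_cons] at hv ⊢
        tauto
      have := supportWeight_sub_lt (hech.mem g (by simp)) (hech.mem v hvG) (hech.monic v hvG) hc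
      rw [← hk]
      simp only [List.map_append, List.map_cons, List.sum_append, List.sum_cons]
      omega
    | finish => exact ⟨_, fun t ht => by cases ht⟩

/-- Lexicographic descent: a cancellation lowers the leading term of `f`, an advance leaves fewer
entries to compare. The zero polynomial is treated apart, as its leading term need not be lower. -/
theorem terminatesFrom_reduce (hσ : IsDegreeOrder σ) {c : Call n} {V W : List (Poly K n)}
    {H : Finset (Poly K n)} {f : Poly K n} {i : ℕ}
    (ih : ∀ W', Inv σ F (.gauss c V W' H) → TerminatesFrom σ F (.gauss c V W' H))
    (h : Inv σ F (.reduce c V W H f i)) : TerminatesFrom σ F (.reduce c V W H f i) := by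
  have hzero : ∀ f i, f = 0 → Inv σ F (.reduce c V W H f i) →
      TerminatesFrom σ F (.reduce c V W H f i) := by
    intro f i hf h
    refine ⟨_, fun t ht => ?_⟩
    have hinv := h.step hσ ht
    cases ht with
    | cancel _ _ _ _ _ _ _ hf0 => exact absurd hf hf0
    | next _ _ _ _ _ _ _ hf0 => exact absurd hf hf0
    | drop => exact ih _ hinv
    | append _ _ _ _ _ _ hf0 => exact absurd hf hf0
  induction hm : c.lead σ f using (c.isLeadFun (K := K) σ).wf.induction generalizing f i with
  | _ m ihm =>
    induction hj : (V ++ W).length - i using Nat.strong_induction_on generalizing i with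
    | _ j ihj =>
      refine ⟨_, fun t ht => ?_⟩
      have hinv := h.step hσ ht
      obtain ⟨E, -, hech, -, hf, -, -⟩ := h
      cases ht with
      | cancel _ _ _ _ _ _ v hf0 hv hl =>
        by_cases h0 : f - C (coeff (c.lead σ f) f) * v = 0
        · exact hzero _ _ h0 hinv
        · have hmem := List.mem_of_getElem? hv
          refine ihm _ ?_ hinv rfl
          rw [← hm]
          exact (c.isLeadFun σ).rel_sub_mul hf (hech.mem v hmem) hl (hech.monic v hmem) h0
      | next _ _ _ _ _ _ v hf0 hv hl =>
        have hi : i < (V ++ W).length := (List.getElem?_eq_some_iff.1 hv).1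
        exact ihj _ (by omega) hinv rfl
      | drop => exact ih _ hinv
      | append => exact ih _ hinv

theorem terminatesFrom_gauss (hσ : IsDegreeOrder σ) {c : Call n} {V : List (Poly K n)}
    (hret : ∀ W, Inv σ F (.returned c V W) → TerminatesFrom σ F (.returned c V W))
    {W : List (Poly K n)} {H : Finset (Poly K n)} (h : Inv σ F (.gauss c V W H)) :
    TerminatesFrom σ F (.gauss c V W H) := by
  classical
  induction hk : H.card using Nat.strong_induction_on generalizing W H with
  | _ k ih =>
    refine ⟨_, fun t ht => ?_⟩
    have hinv := h.step hσ ht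
    cases ht with
    | pick _ _ _ _ f hf =>
      refine terminatesFrom_reduce hσ (fun W' h' => ih _ ?_ h' rfl) hinv
      rw [← hk]
      exact Finset.card_erase_lt_of_mem hf
    | ret => exact hret _ hinv

theorem terminatesFrom_choose (hσ : IsDegreeOrder σ) {d : ℕ} {V : List (Poly K n)}
    (h : Inv σ F (.choose d V)) : TerminatesFrom σ F (.choose d V) := by
  refine ⟨_, fun t ht => ?_⟩
  have hinv := h.step hσ ht
  cases ht
  refine ⟨_, fun t ht => ?_⟩
  have hinv' := hinv.step hσ ht
  cases ht
  refine terminatesFrom_gauss hσ (fun W hW => ⟨_, fun t ht => ?_⟩) hinv'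
  have hinv'' := hW.step hσ ht
  cases ht
  exact terminatesFrom_backSubst hσ hinv''

theorem IsPartialSpan.length_le {d : ℕ} {V : List (Poly K n)} (hσ : IsDegreeOrder σ)
    (h : IsPartialSpan σ F d V) : V.length ≤ (termsLE n d).card := by
  classical
  rw [← List.length_map (f := fun v => σ.degree v), ← List.toFinset_card_of_nodup h.echelon.nodup]
  refine Finset.card_le_card fun m hm => ?_
  obtain ⟨v, hv, rfl⟩ := List.mem_map.1 (List.mem_toFinset.1 hm)
  rw [mem_termsLE, ← hσ.totalDegree_eq]
  exact listSpan_le_polyLE_iff.1 h.le v hv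

theorem terminatesFrom_extend (hσ : IsDegreeOrder σ) {d : ℕ}
    (htest : ∀ V, Inv σ F (.test d V) → TerminatesFrom σ F (.test d V)) {V : List (Poly K n)}
    (h : Inv σ F (.extend d V)) : TerminatesFrom σ F (.extend d V) := by
  induction hk : (termsLE n d).card - V.length using Nat.strong_induction_on generalizing V with
  | _ k ih =>
    refine ⟨_, fun t ht => ?_⟩
    have hinv := h.step hσ ht
    cases ht
    refine terminatesFrom_gauss hσ (fun W hW => ⟨_, fun t ht => ?_⟩) hinv
    have hinv' := hW.step hσ ht
    cases ht with
    | spanMore _ _ _ W' hW' hne =>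
      refine ih _ ?_ hinv' rfl
      -- Leading terms are distinct of degree at most `d`, so only finitely many nonempty extensions
      -- are possible.
      have h1 : (V ++ W').length ≤ (termsLE n d).card := IsPartialSpan.length_le hσ hinv'
      have h2 := List.length_pos_iff.2 hne
      rw [List.length_append] at h1 ⊢
      omega
    | spanStop => exact htest _ hinv'

theorem terminatesFrom_span (hσ : IsDegreeOrder σ)
    (hI : Module.Finite K (Poly K n ⧸ Ideal.span (F : Set (Poly K n)))) {d : ℕ}
    (h : Inv σ F (.span d)) : TerminatesFrom σ F (.span d) := by
  obtain ⟨D, hD⟩ := exists_forall_isStable_degree hσ hI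
  induction hk : D - d using Nat.strong_induction_on generalizing d with
  | _ k ih =>
    refine ⟨_, fun t ht => ?_⟩
    have hinv := h.step hσ ht
    cases ht
    refine terminatesFrom_gauss hσ (fun W hW => ⟨_, fun t ht => ?_⟩) hinv
    have hinv' := hW.step hσ ht
    cases ht
    refine terminatesFrom_extend hσ (fun V hV => ⟨_, fun t ht => ?_⟩) hinv'
    have hinv'' := hV.step hσ ht
    cases ht with
    | increase _ _ hne =>
      refine ih _ ?_ hinv'' rfl
      by_contra hlt
      refine hne fun t ht => ?_
      obtain ⟨u, hu, hu0, rfl⟩ := hD d (by omega) _ hV.2 hV.1.mem_span t ht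
      obtain ⟨v, hv, hvu, -⟩ := (isLeadFun_degree σ).exists_lead_eq hV.1.echelon hu hu0
      exact ⟨v, hv, hvu⟩
    | pass => exact terminatesFrom_choose hσ hinv''

/-! ### Reaching a given order ideal -/

/-- The order ideal for which an elimination transforms the basis, if any. -/
def Call.target {n : ℕ} : Call n → Option (Finset (Mon n))
  | .spanInit _ => none
  | .spanExtend _ => none
  | .basisTrans O _ => some O

/-- The order ideal that has been chosen, if any. -/
def State.target {K : Type*} [Field K] {n : ℕ} : State K n → Option (Finset (Mon n))
  | .span _ => none
  | .gauss c _ _ _ => c.target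
  | .reduce c _ _ _ _ _ => c.target
  | .returned c _ _ => c.target
  | .extend _ _ => none
  | .test _ _ => none
  | .choose _ _ => none
  | .transform _ O => some O
  | .backSubst O _ _ => some O
  | .done O _ => some O

theorem Step.target_eq {s t : State K n} (h : Step σ F s t) (hs : ∀ d V, s ≠ .choose d V) :
    t.target = s.target := by
  cases h with
  | choosePoint => exact absurd rfl (hs _ _)
  | _ => rfl

/-- Only the choice sets the target, and a final state has one; so a finite run that starts without
a target and does not get stuck passes through a choice. -/
theorem exists_reach_choose (hσ : IsDegreeOrder σ)
    (hI : Module.Finite K (Poly K n ⧸ Ideal.span (F : Set (Poly K n)))) {s : State K n}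
    (hacc : TerminatesFrom σ F s) (h : Inv σ F s) (hs : s.target = none) :
    ∃ d V, Relation.ReflTransGen (Step σ F) s (.choose d V) := by
  induction hacc with
  | intro s _ ih =>
    by_cases hch : ∃ d V, s = .choose d V
    · obtain ⟨d, V, rfl⟩ := hch
      exact ⟨d, V, .refl⟩
    · push Not at hch
      rcases h.exists_step hσ hI with ⟨t, ht⟩ | ⟨O, G, rfl⟩
      · obtain ⟨d, V, hr⟩ := ih t ht (h.step hσ ht) ((ht.target_eq hch).trans hs)
        exact ⟨d, V, .head ht hr⟩
      · simp [State.target] at hs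

theorem exists_reach_done (hσ : IsDegreeOrder σ)
    (hI : Module.Finite K (Poly K n ⧸ Ideal.span (F : Set (Poly K n)))) {s : State K n}
    (hacc : TerminatesFrom σ F s) (h : Inv σ F s) {O : Finset (Mon n)} (hs : s.target = some O) :
    ∃ G, Relation.ReflTransGen (Step σ F) s (.done O G) := by
  induction hacc with
  | intro s _ ih =>
    rcases h.exists_step hσ hI with ⟨t, ht⟩ | ⟨O', G, rfl⟩
    · have hch : ∀ d V, s ≠ .choose d V := by
        rintro d V rfl
        simp [State.target] at hs
      obtain ⟨G, hr⟩ := ih t ht (h.step hσ ht) ((ht.target_eq hch).trans hs)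
      exact ⟨G, .head ht hr⟩
    · simp only [State.target, Option.some.injEq] at hs
      exact ⟨G, hs ▸ .refl⟩

theorem step_transform_iff (hσ : IsDegreeOrder σ) {d : ℕ} {V : List (Poly K n)}
    (h : Inv σ F (.choose d V)) (O : Finset (Mon n)) :
    Step σ F (.choose d V) (.transform V O) ↔ O ∈ Lam (Ideal.span (F : Set (Poly K n))) := by
  constructor
  · intro hs
    exact (h.step hσ hs).1
  · intro hO
    obtain ⟨z, hz, hint, rfl⟩ := (IsDegreeBasis.mem_Lam_iff_exists h hσ).1 hO
    exact .choosePoint d V z hz hint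

end

end BorderBasis

end

theorem mainTheorem4 {K : Type*} [Field K] {n : ℕ} (σ : MonomialOrder (Fin n))
    (hσ : BorderBasis.IsDegreeOrder σ) (F : Finset (MvPolynomial (Fin n) K))
    (I : Ideal (MvPolynomial (Fin n) K))
    (hF : Ideal.span (F : Set (MvPolynomial (Fin n) K)) = I)
    (hI : Module.Finite K (MvPolynomial (Fin n) K ⧸ I)) :
    -- every run is finite, and no run gets stuck before it has produced an output
    BorderBasis.Terminates σ F ∧
    (∀ s, BorderBasis.Reachable σ F s → (∀ t, ¬ BorderBasis.Step σ F s t) →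
      ∃ O G, s = BorderBasis.State.done O G) ∧
    -- wherever an order ideal is chosen, the possible choices are exactly the elements of `Λ(I)`
    (∀ d V, BorderBasis.Reachable σ F (BorderBasis.State.choose d V) → ∀ O,
      BorderBasis.Step σ F (BorderBasis.State.choose d V) (BorderBasis.State.transform V O) ↔
        O ∈ BorderBasis.Lam I) ∧
    -- every output is the border basis for the chosen order ideal
    (∀ O G, BorderBasis.Reachable σ F (BorderBasis.State.done O G) →
      O ∈ BorderBasis.Lam I ∧ BorderBasis.IsBorderBasis O I G ∧
        ∀ G', BorderBasis.IsBorderBasis O I G' → G' = G) ∧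
    -- every order ideal in `Λ(I)` is chosen in some run, which then outputs its border basis
    (∀ O ∈ BorderBasis.Lam I, ∃ G, BorderBasis.Reachable σ F (BorderBasis.State.done O G)) := by
  subst hF
  have hstart : BorderBasis.Inv σ F (BorderBasis.start F) := .of_reachable hσ .refl
  have hterm : BorderBasis.Terminates σ F := BorderBasis.terminatesFrom_span hσ hI hstart
  refine ⟨hterm, fun s hs hstuck => ?_, fun d V hs O => ?_, fun O G hs => ?_, fun O hO => ?_⟩
  · exact ((BorderBasis.Inv.of_reachable hσ hs).exists_step hσ hI).resolve_left
      fun ⟨t, ht⟩ => hstuck t ht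
  · exact BorderBasis.step_transform_iff hσ (.of_reachable hσ hs) O
  · obtain ⟨hO, hG⟩ := BorderBasis.Inv.of_reachable hσ hs
    exact ⟨hO, hG, fun G' hG' => hG.unique hG'⟩
  -- Some run reaches a choice, where any element of `Λ(I)` may be taken; the target is kept until
  -- the output.
  · obtain ⟨d, V, hr⟩ := BorderBasis.exists_reach_choose hσ hI hterm hstart rfl
    have hinv : BorderBasis.Inv σ F (.choose d V) := .of_reachable hσ hr
    have hstep := (BorderBasis.step_transform_iff hσ hinv O).2 hO
    obtain ⟨G, hG⟩ := BorderBasis.exists_reach_done hσ hI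
      ((BorderBasis.terminatesFrom_choose hσ hinv).inv hstep) (hinv.step hσ hstep)
      (O := O) rfl
    exact ⟨G, (hr.tail hstep).trans hG⟩
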